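/- Let $\gamma^n$ be the standard Gaussian measure on $\mathbb{R}^n$, $d\gamma^n(x)=(2\pi)^{-n/2}e^{-|x|^2/2}\,dx$, and $\gamma=\gamma^1$. Let $\Phi(t)=\gamma((-\infty,t])$, $\varphi=\Phi'$, and $I(p)=\varphi(\Phi^{-1}(p))$ for $p\in(0,1)$. A $C^1$ function $f:\mathbb{R}^n\to(0,1)$ is said to attain equality in Bobkov's inequality if $\sqrt{I^2(f)+|\nabla f|^2}$ is $\gamma^n$-integrable and $$\int_{\mathbb{R}^n}\sqrt{I^2(f)+|\nabla f|^2}\,d\gamma^n = I\left(\int_{\mathbb{R}^n} f\,d\gamma^n\right).$$ (i) A $C^1$ function $f:\mathbb{R}\to(0,1)$ attains equality in Bobkov's inequality if and only if there are constants $u,v\in\mathbb{R}$ such that $f(t)=\Phi(ut+v)$ for all $t\in\mathbb{R}$. (ii) For every $n$, a $C^1$ function $f:\mathbb{R}^n\to(0,1)$ attains equality in Bobkov's inequality if and only if $f=\Phi\circ\ell$ for some affine function $\ell:\mathbb{R}^n\to\mathbb{R}$, i.e. there are $a\in\mathbb{R}^n$ and $b\in\mathbb{R}$ such that $f(x)=\Phi(\langle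 a,x\rangle+b)$ for all $x\in\mathbb{R}^n$. -/

import Mathlib

open MeasureTheory ProbabilityTheory

noncomputable section

namespace Bobkov

/-- The standard Gaussian measure `γⁿ` on Euclidean space `ℝⁿ`. -/
abbrev gaussian (n : ℕ) : Measure (EuclideanSpace ℝ (Fin n)) :=
  stdGaussian (EuclideanSpace ℝ (Fin n))

/-- The standard Gaussian distribution function `Φ(t) = γ((-∞, t])`. -/
def Φ (t : ℝ) : ℝ := (gaussianReal 0 1).real (Set.Iic t)

/-- The standard Gaussian density `φ = Φ'`. -/
def φ (t : ℝ) : ℝ := gaussianPDFReal 0 1 t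

/-- The inverse of the bijection `Φ : ℝ → (0,1)`; only its values on `(0,1)` are meaningful. -/
def ΦInv (p : ℝ) : ℝ := Function.invFun Φ p

/-- The Gaussian isoperimetric profile `I = φ ∘ Φ⁻¹` on `(0,1)`, extended by `0`
(this is its continuous extension to `[0,1]`). -/
def I (p : ℝ) : ℝ := Set.indicator (Set.Ioo 0 1) (fun q => φ (ΦInv q)) p

/-- `f : ℝ → ℝ` attains equality in Bobkov's inequality: the integral of
`√(I(f)² + (f')²)` is finite and equals `I(∫ f dγ)`. -/
def EqualityCaseReal (f : ℝ → ℝ) : Prop :=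
  Integrable (fun t => Real.sqrt (I (f t) ^ 2 + deriv f t ^ 2)) (gaussianReal 0 1) ∧
    ∫ t, Real.sqrt (I (f t) ^ 2 + deriv f t ^ 2) ∂(gaussianReal 0 1) =
      I (∫ t, f t ∂(gaussianReal 0 1))

/-- `f : ℝⁿ → ℝ` attains equality in Bobkov's inequality: the integral of
`√(I(f)² + |∇f|²)` is finite and equals `I(∫ f dγⁿ)`. -/
def EqualityCase {n : ℕ} (f : EuclideanSpace ℝ (Fin n) → ℝ) : Prop :=
  Integrable (fun x => Real.sqrt (I (f x) ^ 2 + ‖gradient f x‖ ^ 2)) (gaussian n) ∧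
    ∫ x, Real.sqrt (I (f x) ^ 2 + ‖gradient f x‖ ^ 2) ∂(gaussian n) =
      I (∫ x, f x ∂(gaussian n))

end Bobkov

end

namespace Bobkov

open Filter Topology Set

/-! The identities `I' = -Φ⁻¹` and `I I'' = -1` give Bobkov's two-point inequality `two_point`.
Iterated along a symmetric random walk it becomes `discrete_bobkov`, and the central limit theorem
turns this into Bobkov's inequality on the line. Approximation extends it to functions with a
Gaussian-integrable weak derivative (`bobkov_real`), a class broad enough for marginals `t ↦ ∫ f(t,
y) dy`. Higher dimensions follow by induction: the line inequality for the marginal, the inductive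
inequality for the slices, and the Minkowski inequality `|∫ (a, b)| ≤ ∫ |(a, b)|`
(`sqrt_integral_sq_add_le`).

For the equality case the same tensorisation is run on `ℝ × E` for `(t, z) ↦ f (mix e t z)`, where
`mix e` replaces the coordinate `z_e` by `4/5 z_e + 3/5 t` and so carries the Gaussian measure to
itself. Equality for `f` forces equality in Minkowski for almost every `t`. One such `t` is enough,
because `mix e t` maps onto `E`: with `J = √(I(f)² + |∇f|²)`, the derivative of `f` along `e` is a
constant multiple of `J` on the whole space (`exists_fderiv_eq_mul_sqrt`). Summing squares over an
orthonormal basis gives `|∇f|² = W J²`, so `J` is a constant multiple of `I(f)`, and `∇(Φ⁻¹ ∘ f) =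
∇f / I(f)` is constant: `Φ⁻¹ ∘ f` is affine.

The converse is a computation of Gaussian integrals (`equality_Φ`). The line is the case `E = ℝ` of
`equality_iff`. -/

/-! ### The Gaussian distribution function, its inverse and the profile `I`. -/

lemma continuous_φ : Continuous φ := by
  unfold φ; simp only [gaussianPDFReal_def]; fun_prop

lemma φ_pos (t : ℝ) : 0 < φ t := gaussianPDFReal_pos 0 1 t one_ne_zero

lemma φ_eq (t : ℝ) : φ t = (√(2 * Real.pi))⁻¹ * Real.exp (-t ^ 2 / 2) := by
  simp [φ, gaussianPDFReal_def]

lemma φ_le_one (t : ℝ) : φ t ≤ 1 := by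
  rw [φ_eq]
  have h1 : Real.exp (-t ^ 2 / 2) ≤ 1 := Real.exp_le_one_iff.2 (by nlinarith [sq_nonneg t])
  have h2 : 1 ≤ √(2 * Real.pi) := Real.one_le_sqrt.2 (by nlinarith [Real.pi_gt_three])
  have h3 : (√(2 * Real.pi))⁻¹ ≤ 1 := inv_le_one_of_one_le₀ h2
  calc _ ≤ (1 : ℝ) * 1 := by gcongr
    _ = 1 := one_mul 1

lemma hasDerivAt_φ (t : ℝ) : HasDerivAt φ (-t * φ t) t := by
  have : φ = fun t => (√(2 * Real.pi))⁻¹ * Real.exp (-t ^ 2 / 2) := funext φ_eq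
  rw [this]
  have h : HasDerivAt (fun t : ℝ => -t ^ 2 / 2) (-t) t := by
    convert! ((hasDerivAt_pow 2 t).neg.div_const 2) using 1
    simp; ring
  convert! (h.exp.const_mul _) using 1
  ring

lemma integrable_φ : Integrable φ := integrable_gaussianPDFReal 0 1

lemma Φ_eq_integral (t : ℝ) : Φ t = ∫ x in Iic t, φ x := by
  rw [Φ, Measure.real, gaussianReal_apply_eq_integral 0 one_ne_zero, ENNReal.toReal_ofReal]
  · rfl
  · exact setIntegral_nonneg measurableSet_Iic fun x _ => (φ_pos x).le

lemma Φ_sub (a b : ℝ) : Φ b - Φ a = ∫ x in a..b, φ x := by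
  rw [Φ_eq_integral, Φ_eq_integral]
  exact intervalIntegral.integral_Iic_sub_Iic integrable_φ.integrableOn integrable_φ.integrableOn

lemma hasDerivAt_Φ (t : ℝ) : HasDerivAt Φ (φ t) t := by
  have h : HasDerivAt (fun b => Φ 0 + ∫ x in (0 : ℝ)..b, φ x) (φ t) t :=
    (continuous_φ.integral_hasStrictDerivAt 0 t).hasDerivAt.const_add _
  refine h.congr_of_eventuallyEq (Eventually.of_forall fun b => ?_)
  simp [← Φ_sub]

lemma continuous_Φ : Continuous Φ :=
  continuous_iff_continuousAt.2 fun t => (hasDerivAt_Φ t).continuousAt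

lemma strictMono_Φ : StrictMono Φ :=
  strictMono_of_deriv_pos fun t => by rw [(hasDerivAt_Φ t).deriv]; exact φ_pos t

lemma Φ_eq_cdf : Φ = cdf (gaussianReal 0 1) := by
  ext t; rw [cdf_eq_real, Φ]

lemma tendsto_Φ_atTop : Tendsto Φ atTop (𝓝 1) := by
  rw [Φ_eq_cdf]; exact tendsto_cdf_atTop _

lemma tendsto_Φ_atBot : Tendsto Φ atBot (𝓝 0) := by
  rw [Φ_eq_cdf]; exact tendsto_cdf_atBot _

lemma Φ_mem (t : ℝ) : Φ t ∈ Ioo (0 : ℝ) 1 := by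
  constructor
  · exact lt_of_le_of_lt (by rw [Φ_eq_cdf]; exact cdf_nonneg _ _) (strictMono_Φ (sub_one_lt t))
  · exact lt_of_lt_of_le (strictMono_Φ (lt_add_one t)) (by rw [Φ_eq_cdf]; exact cdf_le_one _ _)

lemma ΦInv_Φ (t : ℝ) : ΦInv (Φ t) = t := Function.leftInverse_invFun strictMono_Φ.injective t

lemma exists_Φ_eq {p : ℝ} (hp : p ∈ Ioo (0 : ℝ) 1) : ∃ t, Φ t = p :=
  mem_range_of_exists_le_of_exists_ge continuous_Φ
    (((tendsto_Φ_atBot.eventually (gt_mem_nhds hp.1)).exists).imp fun _ h => le_of_lt h)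
    (((tendsto_Φ_atTop.eventually (lt_mem_nhds hp.2)).exists).imp fun _ h => le_of_lt h)

lemma Φ_ΦInv {p : ℝ} (hp : p ∈ Ioo (0 : ℝ) 1) : Φ (ΦInv p) = p :=
  Function.invFun_eq (exists_Φ_eq hp)

lemma I_of_mem {p : ℝ} (hp : p ∈ Ioo (0 : ℝ) 1) : I p = φ (ΦInv p) := by
  simp only [I, Set.indicator_of_mem hp]

lemma I_Φ (t : ℝ) : I (Φ t) = φ t := by rw [I_of_mem (Φ_mem t), ΦInv_Φ]

lemma I_pos {p : ℝ} (hp : p ∈ Ioo (0 : ℝ) 1) : 0 < I p := by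
  rw [I_of_mem hp]; exact φ_pos _

lemma I_nonneg (p : ℝ) : 0 ≤ I p := indicator_nonneg (fun _ _ => (φ_pos _).le) p

lemma I_le_one (p : ℝ) : I p ≤ 1 :=
  indicator_le' (fun _ _ => φ_le_one _) (fun _ _ => zero_le_one) p

lemma ΦInv_lt_ΦInv {p q : ℝ} (hp : p ∈ Ioo (0 : ℝ) 1) (hq : q ∈ Ioo (0 : ℝ) 1) (h : p < q) :
    ΦInv p < ΦInv q := by
  rw [← strictMono_Φ.lt_iff_lt, Φ_ΦInv hp, Φ_ΦInv hq]; exact h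

lemma hasDerivAt_ΦInv {p : ℝ} (hp : p ∈ Ioo (0 : ℝ) 1) : HasDerivAt ΦInv (I p)⁻¹ p := by
  rw [I_of_mem hp]
  have hmono : StrictMonoOn ΦInv (Ioo 0 1) := fun x hx y hy h => ΦInv_lt_ΦInv hx hy h
  have himg : ΦInv '' Ioo 0 1 = univ := by
    refine eq_univ_of_forall fun t => ⟨Φ t, Φ_mem t, ΦInv_Φ t⟩
  have hc : ContinuousAt ΦInv p :=
    hmono.continuousAt_of_image_mem_nhds (Ioo_mem_nhds hp.1 hp.2) (by rw [himg]; exact univ_mem)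
  refine HasDerivAt.of_local_left_inverse hc (hasDerivAt_Φ _) (φ_pos _).ne' ?_
  filter_upwards [Ioo_mem_nhds hp.1 hp.2] with q hq using Φ_ΦInv hq

lemma hasDerivAt_I {p : ℝ} (hp : p ∈ Ioo (0 : ℝ) 1) : HasDerivAt I (-ΦInv p) p := by
  have h := (hasDerivAt_φ (ΦInv p)).comp p (hasDerivAt_ΦInv hp)
  have h2 : -ΦInv p * φ (ΦInv p) * (I p)⁻¹ = -ΦInv p := by
    rw [← I_of_mem hp, mul_assoc, mul_inv_cancel₀ (I_pos hp).ne', mul_one]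
  rw [h2] at h
  refine h.congr_of_eventuallyEq ?_
  filter_upwards [Ioo_mem_nhds hp.1 hp.2] with q hq using I_of_mem hq

lemma continuousOn_I : ContinuousOn I (Ioo 0 1) :=
  fun _ hp => (hasDerivAt_I hp).continuousAt.continuousWithinAt

lemma φ_neg (t : ℝ) : φ (-t) = φ t := by simp [φ_eq]

lemma Φ_neg (t : ℝ) : Φ (-t) = 1 - Φ t := by
  have hd : ∀ x, HasDerivAt (fun x => Φ (-x) + Φ x) 0 x := fun x => by
    convert! ((hasDerivAt_Φ (-x)).comp x (hasDerivAt_neg x)).add (hasDerivAt_Φ x) using 1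
    simp [φ_neg]
  have hc : ∀ x, (fun x => Φ (-x) + Φ x) x = Φ (-t) + Φ t := fun x =>
    is_const_of_deriv_eq_zero (fun x => (hd x).differentiableAt) (fun x => (hd x).deriv) x t
  have hl : Tendsto (fun x => Φ (-x) + Φ x) atTop (𝓝 (0 + 1)) :=
    (tendsto_Φ_atBot.comp tendsto_neg_atTop_atBot).add tendsto_Φ_atTop
  have := tendsto_nhds_unique (tendsto_const_nhds.congr fun x => (hc x).symm) hl
  linarith

lemma ΦInv_one_sub {p : ℝ} (hp : p ∈ Ioo (0 : ℝ) 1) : ΦInv (1 - p) = -ΦInv p := by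
  rw [← Φ_ΦInv hp, ← Φ_neg, ΦInv_Φ, ΦInv_Φ]

lemma I_one_sub {p : ℝ} (hp : p ∈ Ioo (0 : ℝ) 1) : I (1 - p) = I p := by
  rw [I_of_mem hp, I_of_mem ⟨by linarith [hp.2], by linarith [hp.1]⟩, ΦInv_one_sub hp, φ_neg]

/-! ### The two-point inequality. -/

/-- Used repeatedly on functions vanishing at `0`, to reduce an inequality to the sign of a higher
derivative. -/
lemma nonneg_of_deriv_nonneg {w w' : ℝ → ℝ} {x : ℝ} (h0 : 0 ≤ w 0)
    (hd : ∀ y ∈ Icc 0 x, HasDerivAt w (w' y) y) (hn : ∀ y ∈ Icc 0 x, 0 ≤ w' y) :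
    ∀ y ∈ Icc 0 x, 0 ≤ w y := by
  intro y hy
  have hmono : MonotoneOn w (Icc 0 x) := by
    refine monotoneOn_of_hasDerivWithinAt_nonneg (f' := w') (convex_Icc 0 x)
      (fun z hz => (hd z hz).continuousAt.continuousWithinAt) (fun z hz => ?_) (fun z hz => ?_)
    · exact (hd z (interior_subset hz)).hasDerivWithinAt
    · exact hn z (interior_subset hz)
  exact h0.trans (hmono ⟨le_rfl, hy.1.trans hy.2⟩ hy hy.1)

lemma hasDerivAt_I_sq {p : ℝ} (hp : p ∈ Ioo (0 : ℝ) 1) :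
    HasDerivAt (fun p => I p ^ 2) (-2 * (I p * ΦInv p)) p := by
  convert! (hasDerivAt_I hp).pow 2 using 1
  simp; ring

lemma hasDerivAt_I_mul_ΦInv {p : ℝ} (hp : p ∈ Ioo (0 : ℝ) 1) :
    HasDerivAt (fun p => I p * ΦInv p) (1 - ΦInv p ^ 2) p := by
  convert! (hasDerivAt_I hp).mul (hasDerivAt_ΦInv hp) using 1
  rw [mul_inv_cancel₀ (I_pos hp).ne']; ring

lemma hasDerivAt_ΦInv_sq {p : ℝ} (hp : p ∈ Ioo (0 : ℝ) 1) :
    HasDerivAt (fun p => ΦInv p ^ 2) (2 * (ΦInv p / I p)) p := by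
  convert! (hasDerivAt_ΦInv hp).pow 2 using 1
  simp; ring

lemma hasDerivAt_ΦInv_div_I {p : ℝ} (hp : p ∈ Ioo (0 : ℝ) 1) :
    HasDerivAt (fun p => ΦInv p / I p) ((1 + ΦInv p ^ 2) / I p ^ 2) p := by
  convert! (hasDerivAt_ΦInv hp).div (hasDerivAt_I hp) (I_pos hp).ne' using 1
  have := (I_pos hp).ne'
  field_simp; ring

/-- As `(ΦInv²)' = 2 ΦInv / I`, this expresses the convexity of `ΦInv²`, on which `I_sq_add_ge`
rests. -/
lemma monotoneOn_ΦInv_div_I : MonotoneOn (fun p => ΦInv p / I p) (Ioo 0 1) := by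
  refine monotoneOn_of_hasDerivWithinAt_nonneg (f' := fun p => (1 + ΦInv p ^ 2) / I p ^ 2)
    (convex_Ioo 0 1) (fun z hz => (hasDerivAt_ΦInv_div_I hz).continuousAt.continuousWithinAt)
    (fun z hz => ?_) (fun z hz => by positivity)
  exact (hasDerivAt_ΦInv_div_I (interior_subset hz)).hasDerivWithinAt

lemma ΦInv_mono {p q : ℝ} (hp : p ∈ Ioo (0 : ℝ) 1) (hq : q ∈ Ioo (0 : ℝ) 1) (h : p ≤ q) :
    ΦInv p ≤ ΦInv q := by
  rcases h.eq_or_lt with rfl | h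
  · exact le_rfl
  · exact (ΦInv_lt_ΦInv hp hq h).le

/-- With centre `c ≤ 1/2`, the point `c + y` lies between `c - y` and its reflection `1 - (c - y)`,
where `ΦInv` takes opposite values. -/
lemma abs_ΦInv_add_le {c y : ℝ} (hc : c ≤ 1 / 2) (hy : 0 ≤ y) (h1 : c - y ∈ Ioo (0 : ℝ) 1)
    (h2 : c + y ∈ Ioo (0 : ℝ) 1) : |ΦInv (c + y)| ≤ -ΦInv (c - y) := by
  rw [abs_le]
  refine ⟨by rw [neg_neg]; exact ΦInv_mono h1 h2 (by linarith), ?_⟩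
  rw [← ΦInv_one_sub h1]
  exact ΦInv_mono h2 ⟨by linarith [h1.2], by linarith [h1.1]⟩ (by linarith)

lemma ΦInv_sq_add_le {c y : ℝ} (hc : c ≤ 1 / 2) (hy : 0 ≤ y) (h1 : c - y ∈ Ioo (0 : ℝ) 1)
    (h2 : c + y ∈ Ioo (0 : ℝ) 1) : ΦInv (c + y) ^ 2 ≤ ΦInv (c - y) ^ 2 := by
  have := abs_ΦInv_add_le hc hy h1 h2
  rw [← neg_sq (ΦInv (c - y))]
  exact sq_le_sq' (by linarith [(abs_le.1 this).1]) (abs_le.1 this).2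

lemma I_sq_le_I_sq {p q : ℝ} (hp : p ∈ Ioo (0 : ℝ) 1) (hq : q ∈ Ioo (0 : ℝ) 1)
    (h : ΦInv q ^ 2 ≤ ΦInv p ^ 2) : I p ^ 2 ≤ I q ^ 2 := by
  refine pow_le_pow_left₀ (I_nonneg p) ?_ 2
  rw [I_of_mem hp, I_of_mem hq, φ_eq, φ_eq]
  gcongr

lemma hasDerivAt_comp_add_symm {k k' : ℝ → ℝ} {c y : ℝ} (h2 : HasDerivAt k (k' (c + y)) (c + y))
    (h1 : HasDerivAt k (k' (c - y)) (c - y)) :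
    HasDerivAt (fun y => k (c + y) + k (c - y)) (k' (c + y) - k' (c - y)) y := by
  have e2 : HasDerivAt (fun y => k (c + y)) (k' (c + y)) y := by
    simpa using h2.comp_const_add c y
  have e1 : HasDerivAt (fun y => k (c - y)) (-k' (c - y)) y := by
    simpa using h1.comp_const_sub c y
  simpa [sub_eq_add_neg] using e2.fun_add e1

lemma hasDerivAt_comp_sub_symm {k k' : ℝ → ℝ} {c y : ℝ} (h2 : HasDerivAt k (k' (c + y)) (c + y))
    (h1 : HasDerivAt k (k' (c - y)) (c - y)) :
    HasDerivAt (fun y => k (c + y) - k (c - y)) (k' (c + y) + k' (c - y)) y := by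
  have e2 : HasDerivAt (fun y => k (c + y)) (k' (c + y)) y := by
    simpa using h2.comp_const_add c y
  have e1 : HasDerivAt (fun y => k (c - y)) (-k' (c - y)) y := by
    simpa using h1.comp_const_sub c y
  simpa using e2.fun_sub e1

section TwoPoint

variable {c x : ℝ}

lemma mem_of_mem_Icc (h1 : c - x ∈ Ioo (0 : ℝ) 1) (h2 : c + x ∈ Ioo (0 : ℝ) 1) {y : ℝ}
    (hy : y ∈ Icc 0 x) : c - y ∈ Ioo (0 : ℝ) 1 ∧ c + y ∈ Ioo (0 : ℝ) 1 :=
  ⟨⟨by linarith [h1.1, hy.2], by linarith [h2.2, hy.1, hy.2]⟩,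
    ⟨by linarith [h1.1, hy.2, hy.1], by linarith [h2.2, hy.2]⟩⟩

/-- The right side is the tangent at `x = 0`. Two differentiations leave the sign of `ΦInv (c - y)²
- ΦInv (c + y)²`, known because `c ≤ 1/2`. -/
lemma I_sq_sub_le (hc : c ≤ 1 / 2) (hx : 0 ≤ x) (h1 : c - x ∈ Ioo (0 : ℝ) 1)
    (h2 : c + x ∈ Ioo (0 : ℝ) 1) :
    I (c + x) ^ 2 - I (c - x) ^ 2 ≤ -4 * (I c * ΦInv c) * x := by
  have hm := fun y (hy : y ∈ Icc 0 x) => mem_of_mem_Icc h1 h2 hy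
  have hd1 : ∀ y ∈ Icc 0 x, 0 ≤ 2 * (I (c + y) * ΦInv (c + y) + I (c - y) * ΦInv (c - y))
      - 4 * (I c * ΦInv c) := by
    refine nonneg_of_deriv_nonneg (w' := fun y => 2 * ((1 - ΦInv (c + y) ^ 2) -
      (1 - ΦInv (c - y) ^ 2))) ?_ (fun y hy => ?_) (fun y hy => ?_)
    · simp; apply le_of_eq; ring
    · exact ((hasDerivAt_comp_add_symm (k := fun p => I p * ΦInv p)
        (k' := fun p => 1 - ΦInv p ^ 2) (hasDerivAt_I_mul_ΦInv (hm y hy).2)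
        (hasDerivAt_I_mul_ΦInv (hm y hy).1)).const_mul 2).sub_const _
    · linarith [ΦInv_sq_add_le hc hy.1 (hm y hy).1 (hm y hy).2]
  have := nonneg_of_deriv_nonneg (x := x)
    (w := fun y => -4 * (I c * ΦInv c) * y - (I (c + y) ^ 2 - I (c - y) ^ 2))
    (w' := fun y => -4 * (I c * ΦInv c) * 1 -
      (-2 * (I (c + y) * ΦInv (c + y)) + -2 * (I (c - y) * ΦInv (c - y)))) (by simp)
    (fun y hy => ((hasDerivAt_id y).const_mul _).fun_sub
      (hasDerivAt_comp_sub_symm (k := fun p => I p ^ 2) (k' := fun p => -2 * (I p * ΦInv p))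
        (hasDerivAt_I_sq (hm y hy).2) (hasDerivAt_I_sq (hm y hy).1)))
    (fun y hy => by linarith [hd1 y hy]) x ⟨hx, le_rfl⟩
  linarith

/-- A second-order Taylor bound at `x = 0`: the second derivative of the difference of the two sides
is controlled by convexity of `ΦInv²`. -/
lemma I_sq_add_ge (hx : 0 ≤ x) (h1 : c - x ∈ Ioo (0 : ℝ) 1) (h2 : c + x ∈ Ioo (0 : ℝ) 1) :
    2 * I c ^ 2 + 2 * (ΦInv c * x) ^ 2 ≤ I (c + x) ^ 2 + I (c - x) ^ 2 + 2 * x ^ 2 := by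
  have hm := fun y (hy : y ∈ Icc 0 x) => mem_of_mem_Icc h1 h2 hy
  have hd2 : ∀ y ∈ Icc 0 x, 0 ≤ (ΦInv (c + y) ^ 2 + ΦInv (c - y) ^ 2) - 2 * ΦInv c ^ 2 := by
    refine nonneg_of_deriv_nonneg (w' := fun y => 2 * (ΦInv (c + y) / I (c + y)) -
      2 * (ΦInv (c - y) / I (c - y))) ?_ (fun y hy => ?_) (fun y hy => ?_)
    · simp; apply le_of_eq; ring
    · exact (hasDerivAt_comp_add_symm (k := fun p => ΦInv p ^ 2)
        (k' := fun p => 2 * (ΦInv p / I p)) (hasDerivAt_ΦInv_sq (hm y hy).2)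
        (hasDerivAt_ΦInv_sq (hm y hy).1)).sub_const _
    · have := monotoneOn_ΦInv_div_I (hm y hy).1 (hm y hy).2 (by linarith [hy.1])
      simp only at this
      linarith
  have hd1 : ∀ y ∈ Icc 0 x, 0 ≤ (4 - 4 * ΦInv c ^ 2) * y -
      2 * (I (c + y) * ΦInv (c + y) - I (c - y) * ΦInv (c - y)) := by
    refine nonneg_of_deriv_nonneg (w' := fun y => (4 - 4 * ΦInv c ^ 2) * 1 -
      2 * ((1 - ΦInv (c + y) ^ 2) + (1 - ΦInv (c - y) ^ 2))) (by simp)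
      (fun y hy => ?_) (fun y hy => by linarith [hd2 y hy])
    exact ((hasDerivAt_id y).const_mul _).fun_sub
      ((hasDerivAt_comp_sub_symm (k := fun p => I p * ΦInv p)
        (k' := fun p => 1 - ΦInv p ^ 2) (hasDerivAt_I_mul_ΦInv (hm y hy).2)
        (hasDerivAt_I_mul_ΦInv (hm y hy).1)).const_mul 2)
  have := nonneg_of_deriv_nonneg (x := x)
    (w := fun y => (2 - 2 * ΦInv c ^ 2) * y ^ 2 + (I (c + y) ^ 2 + I (c - y) ^ 2) - 2 * I c ^ 2)
    (w' := fun y => (2 - 2 * ΦInv c ^ 2) * (2 * y) +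
      (-2 * (I (c + y) * ΦInv (c + y)) - -2 * (I (c - y) * ΦInv (c - y))))
    (by simp; apply le_of_eq; ring)
    (fun y hy => (HasDerivAt.fun_add (by simpa using (hasDerivAt_pow 2 y).const_mul _)
      (hasDerivAt_comp_add_symm (k := fun p => I p ^ 2) (k' := fun p => -2 * (I p * ΦInv p))
        (hasDerivAt_I_sq (hm y hy).2) (hasDerivAt_I_sq (hm y hy).1))).sub_const _)
    (fun y hy => by linarith [hd1 y hy]) x ⟨hx, le_rfl⟩
  linarith

/-- The hypothesis rearranges to `(4i² - (a + b)²)(4i² - (a - b)²) ≤ 0`, and `(a - b)² ≤ (a + b)²`,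
so the first factor cannot be positive. -/
lemma two_mul_le_add_of_sq_sub_sq {a b i : ℝ} (ha : 0 ≤ a) (hb : 0 ≤ b) (hi : 0 < i)
    (h : (a ^ 2 - b ^ 2) ^ 2 ≤ 8 * i ^ 2 * (a ^ 2 + b ^ 2 - 2 * i ^ 2)) : 2 * i ≤ a + b := by
  by_contra! hlt
  have h1 : 0 < 4 * i ^ 2 - (a + b) ^ 2 := by nlinarith
  have h2 : 4 * i ^ 2 * (4 * i ^ 2 - (a + b) ^ 2) ≤ (a - b) ^ 2 * (4 * i ^ 2 - (a + b) ^ 2) := by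
    nlinarith
  have h3 := le_of_mul_le_mul_right h2 h1
  nlinarith [mul_nonneg ha hb]

lemma two_point_of_le_half (hc : c ≤ 1 / 2) (hx : 0 ≤ x) (h1 : c - x ∈ Ioo (0 : ℝ) 1)
    (h2 : c + x ∈ Ioo (0 : ℝ) 1) :
    2 * I c ≤ √(I (c + x) ^ 2 + x ^ 2) + √(I (c - x) ^ 2 + x ^ 2) := by
  have hcm : c ∈ Ioo (0 : ℝ) 1 := ⟨by linarith [h1.1], by linarith⟩
  refine two_mul_le_add_of_sq_sub_sq (Real.sqrt_nonneg _) (Real.sqrt_nonneg _) (I_pos hcm) ?_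
  rw [Real.sq_sqrt (by positivity), Real.sq_sqrt (by positivity)]
  have e1 := I_sq_sub_le hc hx h1 h2
  have e0 := I_sq_le_I_sq h1 h2 (ΦInv_sq_add_le hc hx h1 h2)
  have e2 := I_sq_add_ge hx h1 h2
  -- The bounds `e1` and `e2` match exactly: `(4 I(c) ΦInv(c) x)² = 8 I(c)² · 2 (ΦInv(c) x)²`.
  have e3 : (I (c + x) ^ 2 - I (c - x) ^ 2) ^ 2 ≤ (-4 * (I c * ΦInv c) * x) ^ 2 :=
    pow_le_pow_left₀ (by linarith) e1 2
  nlinarith [sq_nonneg (I c)]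

end TwoPoint

/-- Bobkov's two-point inequality. -/
theorem two_point {p q : ℝ} (hp : p ∈ Ioo (0 : ℝ) 1) (hq : q ∈ Ioo (0 : ℝ) 1) :
    2 * I ((p + q) / 2) ≤ √(I p ^ 2 + ((p - q) / 2) ^ 2) + √(I q ^ 2 + ((p - q) / 2) ^ 2) := by
  wlog h : q ≤ p generalizing p q
  · have := this hq hp (le_of_not_ge h)
    rw [add_comm q p, ← neg_sub p q, neg_div, neg_sq] at this
    linarith
  rcases le_total ((p + q) / 2) (1 / 2) with hc | hc
  · have := two_point_of_le_half (c := (p + q) / 2) (x := (p - q) / 2) hc (by linarith)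
      (by convert! hq using 1; ring) (by convert! hp using 1; ring)
    convert! this using 4 <;> ring_nf
  · have hp' : 1 - p ∈ Ioo (0 : ℝ) 1 := ⟨by linarith [hp.2], by linarith [hp.1]⟩
    have hq' : 1 - q ∈ Ioo (0 : ℝ) 1 := ⟨by linarith [hq.2], by linarith [hq.1]⟩
    have := two_point_of_le_half (c := 1 - (p + q) / 2) (x := (p - q) / 2) (by linarith)
      (by linarith) (by convert! hp' using 1; ring) (by convert! hq' using 1; ring)
    rw [I_one_sub ⟨by linarith [hp.1, hq.1], by linarith [hp.2, hq.2]⟩,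
      show 1 - (p + q) / 2 + (p - q) / 2 = 1 - q by ring,
      show 1 - (p + q) / 2 - (p - q) / 2 = 1 - p by ring, I_one_sub hp, I_one_sub hq] at this
    linarith

/-! ### Minkowski's inequality for pairs of integrals, with its equality case. -/

section Minkowski

variable {Ω : Type*} [MeasurableSpace Ω] {P : Measure Ω} {a b : Ω → ℝ}

lemma sqrt_add_sq_mul (x y : ℝ) : √(x ^ 2 + y ^ 2) * √(x ^ 2 + y ^ 2) = x ^ 2 + y ^ 2 :=
  Real.mul_self_sqrt (by positivity)

lemma mul_add_mul_le_sqrt_mul_sqrt (A B x y : ℝ) :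
    A * x + B * y ≤ √(A ^ 2 + B ^ 2) * √(x ^ 2 + y ^ 2) := by
  rw [← Real.sqrt_mul (by positivity)]
  apply Real.le_sqrt_of_sq_le
  nlinarith [sq_nonneg (A * y - B * x)]

lemma integrable_sqrt_add_sq (ha : Integrable a P) (hb : Integrable b P) :
    Integrable (fun ω => √(a ω ^ 2 + b ω ^ 2)) P := by
  refine (ha.abs.add hb.abs).mono' ?_ (Eventually.of_forall fun ω => ?_)
  · exact Real.continuous_sqrt.comp_aestronglyMeasurable
      ((ha.aestronglyMeasurable.pow 2).add (hb.aestronglyMeasurable.pow 2))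
  · rw [Real.norm_of_nonneg (Real.sqrt_nonneg _)]
    apply Real.sqrt_le_iff.2 ⟨by simp; positivity, ?_⟩
    simp only [Pi.add_apply]
    nlinarith [sq_abs (a ω), sq_abs (b ω), mul_nonneg (abs_nonneg (a ω)) (abs_nonneg (b ω))]

lemma integral_mul_add_mul (ha : Integrable a P) (hb : Integrable b P) (A B : ℝ) :
    ∫ ω, (A * a ω + B * b ω) ∂P = A * ∫ ω, a ω ∂P + B * ∫ ω, b ω ∂P := by
  rw [integral_add (ha.const_mul A) (hb.const_mul B), integral_const_mul, integral_const_mul]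

/-- Pair `(a, b)` with the fixed vector `(A, B)` of integrals, apply Cauchy–Schwarz pointwise and
integrate. -/
theorem sqrt_integral_sq_add_le (ha : Integrable a P) (hb : Integrable b P) :
    √((∫ ω, a ω ∂P) ^ 2 + (∫ ω, b ω ∂P) ^ 2) ≤ ∫ ω, √(a ω ^ 2 + b ω ^ 2) ∂P := by
  set A := ∫ ω, a ω ∂P with hA
  set B := ∫ ω, b ω ∂P with hB
  rcases (Real.sqrt_nonneg (A ^ 2 + B ^ 2)).eq_or_lt with h0 | hpos
  · rw [← h0]; exact integral_nonneg fun _ => Real.sqrt_nonneg _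
  refine le_of_mul_le_mul_left ?_ hpos
  rw [sqrt_add_sq_mul, ← integral_const_mul]
  calc A ^ 2 + B ^ 2 = ∫ ω, (A * a ω + B * b ω) ∂P := by
        rw [integral_mul_add_mul ha hb, pow_two, pow_two]
    _ ≤ _ := integral_mono ((ha.const_mul A).add (hb.const_mul B))
        ((integrable_sqrt_add_sq ha hb).const_mul _)
        fun ω => mul_add_mul_le_sqrt_mul_sqrt A B (a ω) (b ω)

/-- Equality forces the pointwise Cauchy–Schwarz defect, which is nonnegative with zero integral, to
vanish almost everywhere. Then `(a, b)` is parallel to `(A, B)`. -/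
theorem ae_eq_of_integral_sqrt_le (ha : Integrable a P) (hb : Integrable b P)
    (h : ∫ ω, √(a ω ^ 2 + b ω ^ 2) ∂P ≤ √((∫ ω, a ω ∂P) ^ 2 + (∫ ω, b ω ∂P) ^ 2)) :
    ∀ᵐ ω ∂P, (∫ ω, a ω ∂P) * b ω = (∫ ω, b ω ∂P) * a ω := by
  set A := ∫ ω, a ω ∂P with hA
  set B := ∫ ω, b ω ∂P with hB
  have hi1 : Integrable (fun ω => A * a ω + B * b ω) P := (ha.const_mul A).add (hb.const_mul B)
  have hi2 := (integrable_sqrt_add_sq ha hb).const_mul √(A ^ 2 + B ^ 2)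
  have hle : ∀ ω, A * a ω + B * b ω ≤ √(A ^ 2 + B ^ 2) * √(a ω ^ 2 + b ω ^ 2) :=
    fun ω => mul_add_mul_le_sqrt_mul_sqrt A B (a ω) (b ω)
  have hint : ∫ ω, (√(A ^ 2 + B ^ 2) * √(a ω ^ 2 + b ω ^ 2) - (A * a ω + B * b ω)) ∂P = 0 := by
    refine le_antisymm ?_ (integral_nonneg fun ω => sub_nonneg.2 (hle ω))
    rw [integral_sub hi2 hi1, integral_mul_add_mul ha hb, integral_const_mul]
    nlinarith [sqrt_add_sq_mul A B, mul_le_mul_of_nonneg_left h (Real.sqrt_nonneg (A ^ 2 + B ^ 2))]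
  have hae := (integral_eq_zero_iff_of_nonneg (fun ω => sub_nonneg.2 (hle ω)) (hi2.sub hi1)).1 hint
  filter_upwards [hae] with ω hω
  have h1 : √(A ^ 2 + B ^ 2) * √(a ω ^ 2 + b ω ^ 2) = A * a ω + B * b ω := sub_eq_zero.1 hω
  have h2 : (A ^ 2 + B ^ 2) * (a ω ^ 2 + b ω ^ 2) = (A * a ω + B * b ω) ^ 2 := by
    rw [← h1, mul_pow, Real.sq_sqrt (by positivity), Real.sq_sqrt (by positivity)]
  have h3 : (A * b ω - B * a ω) ^ 2 = 0 := by linarith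
  exact sub_eq_zero.1 (pow_eq_zero_iff two_ne_zero |>.1 h3)

end Minkowski

lemma integral_mem_Ioo {Ω : Type*} [MeasurableSpace Ω] {P : Measure Ω} [IsProbabilityMeasure P]
    {f : Ω → ℝ} (hm : AEStronglyMeasurable f P) (hf : ∀ ω, f ω ∈ Ioo (0 : ℝ) 1) :
    ∫ ω, f ω ∂P ∈ Ioo (0 : ℝ) 1 := by
  have hi : Integrable f P := Integrable.of_bound hm 1 (Eventually.of_forall fun ω => by
    rw [Real.norm_of_nonneg (hf ω).1.le]; exact (hf ω).2.le)
  have hP : P univ ≠ 0 := by simp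
  constructor
  · rw [integral_pos_iff_support_of_nonneg (fun ω => (hf ω).1.le) hi,
      Function.support_eq_univ fun ω => (hf ω).1.ne']
    exact pos_iff_ne_zero.2 hP
  · have : 0 < ∫ ω, (1 - f ω) ∂P := by
      rw [integral_pos_iff_support_of_nonneg (fun ω => (sub_pos.2 (hf ω).2).le)
        ((integrable_const 1).sub hi), Function.support_eq_univ fun ω => (sub_pos.2 (hf ω).2).ne']
      exact pos_iff_ne_zero.2 hP
    rw [integral_sub (integrable_const 1) hi] at this
    simpa using this

/-! ### The discrete inequality along a random walk. -/

/-- The averaging operator of the symmetric random walk with step `δ`. -/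
noncomputable def avg (δ : ℝ) (f : ℝ → ℝ) (x : ℝ) : ℝ := (f (x + δ) + f (x - δ)) / 2

lemma avg_mono {δ : ℝ} {f g : ℝ → ℝ} (h : ∀ x, f x ≤ g x) (x : ℝ) : avg δ f x ≤ avg δ g x := by
  have h1 := h (x + δ)
  have h2 := h (x - δ)
  unfold avg; linarith

lemma iterate_avg_mono {δ : ℝ} (n : ℕ) {f g : ℝ → ℝ} (h : ∀ x, f x ≤ g x) (x : ℝ) :
    (avg δ)^[n] f x ≤ (avg δ)^[n] g x := by
  induction n generalizing f g with
  | zero => exact h x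
  | succ n ih => exact ih (avg_mono h)

lemma avg_mem {δ : ℝ} {f : ℝ → ℝ} (hf : ∀ x, f x ∈ Ioo (0 : ℝ) 1) (x : ℝ) :
    avg δ f x ∈ Ioo (0 : ℝ) 1 := by
  have h1 := hf (x + δ)
  have h2 := hf (x - δ)
  unfold avg
  exact ⟨by linarith [h1.1, h2.1], by linarith [h1.2, h2.2]⟩

lemma sqrt_add_sq_add_le (a b c d : ℝ) :
    √((a + b) ^ 2 + (c + d) ^ 2) ≤ √(a ^ 2 + c ^ 2) + √(b ^ 2 + d ^ 2) := by
  rcases (Real.sqrt_nonneg ((a + b) ^ 2 + (c + d) ^ 2)).eq_or_lt with h0 | hpos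
  · rw [← h0]; positivity
  refine le_of_mul_le_mul_left ?_ hpos
  rw [sqrt_add_sq_mul]
  linarith [mul_add_mul_le_sqrt_mul_sqrt (a + b) (c + d) a c,
    mul_add_mul_le_sqrt_mul_sqrt (a + b) (c + d) b d]

/-- `w` controls the symmetric differences of `f` at scale `δ`, from both endpoints. -/
def DiffBound (δ : ℝ) (f w : ℝ → ℝ) : Prop :=
  ∀ x, |f (x + δ) - f (x - δ)| / 2 ≤ δ * w (x + δ) ∧ |f (x + δ) - f (x - δ)| / 2 ≤ δ * w (x - δ)

/-- Differences commute with averaging, and the bounds at right endpoints, like those at left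
endpoints, average among themselves. -/
lemma DiffBound.avg {δ : ℝ} {f w : ℝ → ℝ} (h : DiffBound δ f w) :
    DiffBound δ (avg δ f) (avg δ w) := by
  intro x
  have h1 := h (x + δ)
  have h2 := h (x - δ)
  have habs : |Bobkov.avg δ f (x + δ) - Bobkov.avg δ f (x - δ)| ≤
      |f (x + δ + δ) - f (x + δ - δ)| / 2 + |f (x - δ + δ) - f (x - δ - δ)| / 2 := by
    unfold Bobkov.avg
    rw [← abs_of_pos (two_pos (α := ℝ)), ← abs_div, ← abs_div, abs_of_pos (two_pos (α := ℝ))]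
    refine le_trans (le_of_eq ?_) (abs_add_le _ _)
    congr 1
    simp only [add_sub_cancel_right, sub_add_cancel]
    ring
  unfold Bobkov.avg at habs ⊢
  simp only [add_sub_cancel_right, sub_add_cancel] at h1 h2 habs ⊢
  constructor <;> linarith [h1.1, h1.2, h2.1, h2.2]

/-- The two-point inequality at `x ± δ` handles the `I` term and Minkowski adds the `√τ w` term. The
half-difference of `f`, at most `δ w` at either endpoint, is what raises `τ` to `τ + δ²`. -/
lemma avg_step {δ τ : ℝ} {f w : ℝ → ℝ} (hf : ∀ x, f x ∈ Ioo (0 : ℝ) 1)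
    (hτ : 0 ≤ τ) (h : DiffBound δ f w) (x : ℝ) :
    √(I (avg δ f x) ^ 2 + τ * avg δ w x ^ 2) ≤
      avg δ (fun y => √(I (f y) ^ 2 + (τ + δ ^ 2) * w y ^ 2)) x := by
  have h1 : ∀ y, |f (x + δ) - f (x - δ)| / 2 ≤ δ * w y →
      √(√(I (f y) ^ 2 + ((f (x + δ) - f (x - δ)) / 2) ^ 2) ^ 2 + (√τ * w y) ^ 2) ≤
        √(I (f y) ^ 2 + (τ + δ ^ 2) * w y ^ 2) := fun y hy => by
    rw [Real.sq_sqrt (by positivity), mul_pow, Real.sq_sqrt hτ]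
    have h2 : ((f (x + δ) - f (x - δ)) / 2) ^ 2 ≤ (δ * w y) ^ 2 := by
      rw [← sq_abs, abs_div, abs_two]
      exact pow_le_pow_left₀ (by positivity) hy 2
    exact Real.sqrt_le_sqrt (by linarith)
  have htp := two_point (hf (x + δ)) (hf (x - δ))
  set a := √(I (f (x + δ)) ^ 2 + ((f (x + δ) - f (x - δ)) / 2) ^ 2) with ha
  set b := √(I (f (x - δ)) ^ 2 + ((f (x + δ) - f (x - δ)) / 2) ^ 2) with hb
  have h3 := sqrt_add_sq_add_le a b (√τ * w (x + δ)) (√τ * w (x - δ))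
  have h4 : √(I (avg δ f x) ^ 2 + τ * avg δ w x ^ 2) ≤
      √((a + b) ^ 2 + (√τ * w (x + δ) + √τ * w (x - δ)) ^ 2) / 2 := by
    rw [le_div_iff₀ two_pos, ← Real.sqrt_sq (two_pos (α := ℝ)).le,
      ← Real.sqrt_mul (by positivity)]
    refine Real.sqrt_le_sqrt ?_
    rw [← mul_add √τ, mul_pow, Real.sq_sqrt hτ]
    have h5 := pow_le_pow_left₀ (mul_nonneg zero_le_two (I_nonneg _)) htp 2
    unfold avg
    linarith
  have h6 := h1 _ (h x).1
  have h7 := h1 _ (h x).2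
  rw [← ha] at h6
  rw [← hb] at h7
  unfold avg at h4 ⊢
  linarith

lemma discrete_bobkov {δ : ℝ} (n : ℕ) {τ : ℝ} (hτ : 0 ≤ τ) {f w : ℝ → ℝ}
    (hf : ∀ x, f x ∈ Ioo (0 : ℝ) 1) (h : DiffBound δ f w) (x : ℝ) :
    √(I ((avg δ)^[n] f x) ^ 2 + τ * (avg δ)^[n] w x ^ 2) ≤
      (avg δ)^[n] (fun y => √(I (f y) ^ 2 + (τ + n * δ ^ 2) * w y ^ 2)) x := by
  induction n generalizing f w with
  | zero => simp
  | succ n ih =>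
    refine (ih (avg_mem hf) h.avg).trans ?_
    simp only [Function.iterate_succ, Function.comp]
    refine iterate_avg_mono n (fun y => (avg_step hf (by positivity) h y).trans (le_of_eq ?_)) x
    congr 2
    ext y
    push_cast
    ring_nf

/-! ### Central limit theorem and the smooth inequality on the line. -/

/-- The law of one step of the symmetric random walk with step `δ`. -/
noncomputable def stepMeasure (δ : ℝ) : Measure ℝ :=
  (2⁻¹ : NNReal) • Measure.dirac δ + (2⁻¹ : NNReal) • Measure.dirac (-δ)

instance (δ : ℝ) : IsProbabilityMeasure (stepMeasure δ) where
  measure_univ := by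
    simp only [stepMeasure, Measure.add_apply, Measure.smul_apply, measure_univ]
    rw [← add_smul, ← two_mul, mul_inv_cancel₀ two_ne_zero, one_smul]

/-- The law of the symmetric random walk with step `δ` after `n` steps. -/
noncomputable def walk (δ : ℝ) : ℕ → Measure ℝ
  | 0 => Measure.dirac 0
  | n + 1 => walk δ n ∗ stepMeasure δ

instance (δ : ℝ) (n : ℕ) : IsProbabilityMeasure (walk δ n) := by
  induction n with
  | zero => unfold walk; infer_instance
  | succ n ih => unfold walk; infer_instance

lemma integral_stepMeasure {E : Type*} [NormedAddCommGroup E] [NormedSpace ℝ E] [CompleteSpace E]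
    (δ : ℝ) (f : ℝ → E) :
    ∫ x, f x ∂(stepMeasure δ) = (2⁻¹ : ℝ) • (f δ + f (-δ)) := by
  rw [stepMeasure, integral_add_measure]
  · rw [integral_smul_nnreal_measure, integral_smul_nnreal_measure, integral_dirac, integral_dirac,
      smul_add]
    rfl
  · exact (integrable_dirac (by simp)).smul_measure_nnreal
  · exact (integrable_dirac (by simp)).smul_measure_nnreal

lemma integral_walk (δ : ℝ) (n : ℕ) {f : ℝ → ℝ} (hf : Continuous f) {C : ℝ}
    (hC : ∀ x, |f x| ≤ C) : ∫ x, f x ∂(walk δ n) = (avg δ)^[n] f 0 := by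
  induction n generalizing f with
  | zero => simp [walk]
  | succ n ih =>
    rw [walk, integral_conv (Integrable.of_bound hf.aestronglyMeasurable C
      (Eventually.of_forall hC))]
    have : ∀ x, ∫ y, f (x + y) ∂(stepMeasure δ) = avg δ f x := fun x => by
      rw [integral_stepMeasure, avg, smul_eq_mul, sub_eq_add_neg]; ring
    simp only [this, Function.iterate_succ, Function.comp]
    refine ih (by unfold avg; fun_prop) fun x => ?_
    have h1 := abs_le.1 (hC (x + δ))
    have h2 := abs_le.1 (hC (x - δ))
    unfold avg
    exact abs_le.2 ⟨by linarith [h1.1, h2.1], by linarith [h1.2, h2.2]⟩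

lemma charFun_walk (δ : ℝ) (n : ℕ) (t : ℝ) :
    charFun (walk δ n) t = charFun (stepMeasure 1) (δ * t) ^ n := by
  have h : stepMeasure δ = (stepMeasure 1).map (fun x => δ * x) := by
    rw [stepMeasure, stepMeasure, Measure.map_add _ _ (by fun_prop), Measure.map_smul,
      Measure.map_smul, Measure.map_dirac' (by fun_prop), Measure.map_dirac' (by fun_prop)]
    simp
  induction n with
  | zero => simp [walk]
  | succ n ih => rw [walk, charFun_conv, ih, h, charFun_map_mul, pow_succ]

lemma tendsto_integral_walk {f : ℝ → ℝ} (hf : Continuous f) {C : ℝ} (hC : ∀ x, |f x| ≤ C) :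
    Tendsto (fun n : ℕ => (avg (√n)⁻¹)^[n] f 0) atTop (𝓝 (∫ x, f x ∂(gaussianReal 0 1))) := by
  let μ (n : ℕ) : ProbabilityMeasure ℝ := ⟨walk (√n)⁻¹ n, inferInstance⟩
  let γ : ProbabilityMeasure ℝ := ⟨gaussianReal 0 1, inferInstance⟩
  have h : Tendsto μ atTop (𝓝 γ) := by
    refine ProbabilityMeasure.tendsto_iff_tendsto_charFun.2 fun t => ?_
    simp only [μ, γ, ProbabilityMeasure.coe_mk, charFun_walk, charFun_gaussianReal]
    -- A `±1` step has mean `0` and second moment `1`, so the step length `1/√n` gives the standard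
    -- Gaussian in the limit.
    have := tendsto_charFun_inv_sqrt_mul_pow (P := stepMeasure 1) (X := id) aemeasurable_id
      (by simp [integral_stepMeasure]) (by simp [integral_stepMeasure]; norm_num) t
    simpa [Measure.map_id, neg_div] using this
  have := ProbabilityMeasure.tendsto_iff_forall_integral_tendsto.1 h
    (BoundedContinuousFunction.ofNormedAddCommGroup f hf C hC)
  refine this.congr fun n => ?_
  exact integral_walk _ _ hf hC

/-- By the mean value theorem the slope is `v c` with `c` within `2δ` of both endpoints; `ω` absorbs
the oscillation of `v` at that scale. -/
lemma diffBound_of_hasDerivAt {f v : ℝ → ℝ} (hd : ∀ t, HasDerivAt f (v t) t) {ω η δ : ℝ}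
    (hη : ∀ x y, |x - y| < η → |v x - v y| ≤ ω) (hδ : 0 < δ) (hδη : 2 * δ < η) :
    DiffBound δ f (fun t => |v t| + ω) := by
  intro x
  obtain ⟨c, hc, hs⟩ := exists_hasDerivAt_eq_slope f v (a := x - δ) (b := x + δ) (by linarith)
    (fun y _ => (hd y).continuousAt.continuousWithinAt) (fun y _ => hd y)
  have h2 : f (x + δ) - f (x - δ) = 2 * δ * v c := by
    rw [hs, show x + δ - (x - δ) = 2 * δ by ring]; field_simp
  rw [h2, abs_mul, abs_of_pos (by linarith : 0 < 2 * δ)]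
  have key : ∀ y, |c - y| < η → 2 * δ * |v c| / 2 ≤ δ * (|v y| + ω) := fun y hy => by
    have h3 := hη c y hy
    have h4 := abs_sub_abs_le_abs_sub (v c) (v y)
    nlinarith
  constructor <;> refine key _ ?_ <;> rw [abs_lt] <;> constructor <;> linarith [hc.1, hc.2]

lemma sqrt_add_sq_le_add {a b c : ℝ} (hc : 0 ≤ c) :
    √(a ^ 2 + (b + c) ^ 2) ≤ √(a ^ 2 + b ^ 2) + c := by
  have := sqrt_add_sq_add_le a 0 b c
  simpa [Real.sqrt_sq hc] using this

/-- Bobkov's inequality on the line, for functions with bounded uniformly continuous derivative. -/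
theorem bobkov_real_of_uniformContinuous {f v : ℝ → ℝ} (hf : ∀ t, f t ∈ Ioo (0 : ℝ) 1)
    (hd : ∀ t, HasDerivAt f (v t) t) (hv : UniformContinuous v) {C : ℝ} (hC : ∀ t, |v t| ≤ C) :
    I (∫ t, f t ∂(gaussianReal 0 1)) ≤ ∫ t, √(I (f t) ^ 2 + v t ^ 2) ∂(gaussianReal 0 1) := by
  have hfc : Continuous f := continuous_iff_continuousAt.2 fun t => (hd t).continuousAt
  have hIf : Continuous fun t => I (f t) := continuousOn_I.comp_continuous hfc hf
  have hvc := hv.continuous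
  have hbd : ∀ t, |f t| ≤ 1 := fun t => by rw [abs_of_pos (hf t).1]; exact (hf t).2.le
  have hC0 : 0 ≤ C := (abs_nonneg _).trans (hC 0)
  have hi : Integrable v (gaussianReal 0 1) :=
    Integrable.of_bound hvc.aestronglyMeasurable C (Eventually.of_forall hC)
  have hiI : Integrable (fun t => I (f t)) (gaussianReal 0 1) :=
    Integrable.of_bound hIf.aestronglyMeasurable 1 (Eventually.of_forall fun t => by
      rw [Real.norm_of_nonneg (I_nonneg _)]; exact I_le_one _)
  refine le_of_forall_pos_le_add fun ω hω => ?_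
  obtain ⟨η, hη, hηω⟩ := Metric.uniformContinuous_iff.1 hv ω hω
  have hB : ∀ t, |√(I (f t) ^ 2 + (|v t| + ω) ^ 2)| ≤ 1 + (C + ω) := fun t => by
    rw [abs_of_nonneg (Real.sqrt_nonneg _)]
    refine Real.sqrt_le_iff.2 ⟨by linarith, ?_⟩
    nlinarith [I_nonneg (f t), I_le_one (f t), hC t, abs_nonneg (v t)]
  have hlim1 := tendsto_integral_walk hfc hbd
  have hlim2 := tendsto_integral_walk (f := fun t => √(I (f t) ^ 2 + (|v t| + ω) ^ 2))
    (by fun_prop) hB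
  have hm := integral_mem_Ioo (P := gaussianReal 0 1) hfc.aestronglyMeasurable hf
  have hlim3 := (hasDerivAt_I hm).continuousAt.tendsto.comp hlim1
  have h0 : Tendsto (fun n : ℕ => (√(n : ℝ))⁻¹) atTop (𝓝 0) :=
    tendsto_inv_atTop_zero.comp (Real.tendsto_sqrt_atTop.comp tendsto_natCast_atTop_atTop)
  have hle : I (∫ t, f t ∂(gaussianReal 0 1)) ≤
      ∫ t, √(I (f t) ^ 2 + (|v t| + ω) ^ 2) ∂(gaussianReal 0 1) := by
    refine le_of_tendsto_of_tendsto hlim3 hlim2 ?_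
    filter_upwards [h0.eventually (gt_mem_nhds (half_pos hη)), eventually_gt_atTop 0] with n hn hn0
    have hn0' : (0 : ℝ) < n := Nat.cast_pos.2 hn0
    have hδ : 0 < (√(n : ℝ))⁻¹ := inv_pos.2 (Real.sqrt_pos.2 hn0')
    have hD := diffBound_of_hasDerivAt hd (ω := ω) (η := η)
      (fun x y h => (hηω (by rwa [Real.dist_eq])).le) hδ (by linarith)
    have := discrete_bobkov n le_rfl hf hD 0
    -- With `δ = 1/√n` and initial `τ = 0`, the accumulated coefficient `n δ²` is exactly `1`.
    rw [inv_pow, Real.sq_sqrt hn0'.le, mul_inv_cancel₀ hn0'.ne'] at this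
    simpa [Real.sqrt_sq (I_nonneg _)] using this
  refine hle.trans ?_
  have h1 : ∫ t, (√(I (f t) ^ 2 + v t ^ 2) + ω) ∂(gaussianReal 0 1) =
      ∫ t, √(I (f t) ^ 2 + v t ^ 2) ∂(gaussianReal 0 1) + ω := by
    rw [integral_add (integrable_sqrt_add_sq hiI hi) (integrable_const ω)]
    simp
  rw [← h1]
  refine integral_mono (integrable_sqrt_add_sq hiI (hi.abs.add (integrable_const ω)))
    ((integrable_sqrt_add_sq hiI hi).add (integrable_const ω)) fun t => ?_
  simpa using sqrt_add_sq_le_add (a := I (f t)) (b := |v t|) hω.le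

/-! ### Extension to weak derivatives. -/

/-- The Gaussian density has a positive minimum on a compact interval. Hence Gaussian integrability
implies local Lebesgue integrability. -/
lemma exists_restrict_uIoc_le_smul_gaussianReal (a b : ℝ) :
    ∃ C : NNReal, volume.restrict (uIoc a b) ≤ C • gaussianReal 0 1 := by
  obtain ⟨x₀, -, hx₀⟩ := isCompact_uIcc.exists_isMinOn (nonempty_uIcc (a := a) (b := b))
    continuous_φ.continuousOn
  refine ⟨(Real.toNNReal (φ x₀))⁻¹, Measure.le_iff.2 fun s hs => ?_⟩
  have hm0 : Real.toNNReal (φ x₀) ≠ 0 := (Real.toNNReal_pos.2 (φ_pos x₀)).ne'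
  rw [Measure.restrict_apply hs, Measure.smul_apply, gaussianReal_apply 0 one_ne_zero]
  have h1 : (Real.toNNReal (φ x₀)) • volume (s ∩ uIoc a b) ≤ ∫⁻ x in s, gaussianPDF 0 1 x := by
    calc (Real.toNNReal (φ x₀)) • volume (s ∩ uIoc a b)
        = ∫⁻ _ in s ∩ uIoc a b, ENNReal.ofReal (φ x₀) := by
          rw [setLIntegral_const]; rfl
      _ ≤ ∫⁻ x in s ∩ uIoc a b, gaussianPDF 0 1 x := by
          refine setLIntegral_mono' (hs.inter measurableSet_uIoc) fun x hx => ?_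
          exact ENNReal.ofReal_le_ofReal (hx₀ (uIoc_subset_uIcc hx.2))
      _ ≤ ∫⁻ x in s, gaussianPDF 0 1 x := lintegral_mono_set inter_subset_left
  calc volume (s ∩ uIoc a b)
      = (Real.toNNReal (φ x₀))⁻¹ • (Real.toNNReal (φ x₀)) • volume (s ∩ uIoc a b) := by
        rw [smul_smul, inv_mul_cancel₀ hm0, one_smul]
    _ ≤ _ := by gcongr

lemma intervalIntegrable_of_integrable_gaussianReal {V : ℝ → ℝ}
    (hV : Integrable V (gaussianReal 0 1)) (a b : ℝ) : IntervalIntegrable V volume a b := by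
  obtain ⟨C, hC⟩ := exists_restrict_uIoc_le_smul_gaussianReal a b
  rw [intervalIntegrable_iff, IntegrableOn]
  exact (hV.smul_measure_nnreal (c := C)).mono_measure hC

lemma integral_gaussianReal_le_integral {g : ℝ → ℝ} (h0 : ∀ x, 0 ≤ g x) (hg : Integrable g) :
    ∫ x, g x ∂(gaussianReal 0 1) ≤ ∫ x, g x := by
  rw [integral_gaussianReal_eq_integral_smul one_ne_zero]
  refine integral_mono_of_nonneg (Eventually.of_forall fun x => ?_) hg
    (Eventually.of_forall fun x => ?_)
  · exact smul_nonneg (φ_pos x).le (h0 x)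
  · exact mul_le_of_le_one_left (h0 x) (φ_le_one x)

lemma Integrable.gaussianReal {g : ℝ → ℝ} (hg : Integrable g) :
    Integrable g (gaussianReal 0 1) := by
  refine hg.mono_measure (Measure.le_iff.2 fun s hs => ?_)
  rw [gaussianReal_apply 0 one_ne_zero, ← setLIntegral_one]
  refine lintegral_mono fun x => ?_
  exact ENNReal.ofReal_le_one.2 (φ_le_one x)

lemma integrable_I_comp {Ω : Type*} [MeasurableSpace Ω] {P : Measure Ω} [IsFiniteMeasure P]
    {F : Ω → ℝ} (hF : AEMeasurable F P) :
    Integrable (fun t => I (F t)) P := by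
  have hI : Measurable I := by
    have : I = (Ioo (0 : ℝ) 1).piecewise I 0 := by
      ext p
      by_cases hp : p ∈ Ioo (0 : ℝ) 1
      · rw [piecewise_eq_of_mem _ _ _ hp]
      · rw [piecewise_eq_of_notMem _ _ _ hp, I, indicator_of_notMem hp, Pi.zero_apply]
    rw [this]
    exact continuousOn_I.measurable_piecewise continuousOn_const measurableSet_Ioo
  refine Integrable.of_bound (hI.comp_aemeasurable hF).aestronglyMeasurable 1
    (Eventually.of_forall fun t => ?_)
  rw [Real.norm_of_nonneg (I_nonneg _)]; exact I_le_one _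

/-- Bobkov's inequality on the line for a function with integrable weak derivative and values in a
compact subinterval of `(0, 1)`. -/
theorem bobkov_real_of_integrable {F V : ℝ → ℝ} {η : ℝ} (hη : 0 < η)
    (hF : ∀ t, F t ∈ Icc η (1 - η)) (hV : Integrable V)
    (hd : ∀ t, F t = F 0 + ∫ x in (0 : ℝ)..t, V x) :
    I (∫ t, F t ∂(gaussianReal 0 1)) ≤ ∫ t, √(I (F t) ^ 2 + V t ^ 2) ∂(gaussianReal 0 1) := by
  have hF' : ∀ t, F t ∈ Ioo (0 : ℝ) 1 := fun t => ⟨hη.trans_le (hF t).1, by linarith [(hF t).2]⟩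
  have hFc : Continuous F := by
    rw [funext hd]
    exact continuous_const.add (intervalIntegral.continuous_primitive
      (fun a b => hV.intervalIntegrable) 0)
  obtain ⟨u, -, hu, hu0⟩ := exists_seq_strictAnti_tendsto' hη
  choose g hgs hgi hgc hgint using fun n => hV.exists_hasCompactSupport_integral_sub_le (hu n).1
  set G : ℕ → ℝ → ℝ := fun n t => F 0 + ∫ x in (0 : ℝ)..t, g n x with hG
  have hGF : ∀ n t, |G n t - F t| ≤ u n := fun n t => by
    rw [hd t, hG]
    simp only [add_sub_add_left_eq_sub]
    rw [← intervalIntegral.integral_sub (hgint n).intervalIntegrable hV.intervalIntegrable,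
      ← Real.norm_eq_abs]
    refine (intervalIntegral.norm_integral_le_integral_norm_uIoc).trans ?_
    refine le_trans (setIntegral_le_integral ((hgint n).sub hV).norm
      (Eventually.of_forall fun x => norm_nonneg _)) ?_
    refine le_trans (le_of_eq ?_) (hgi n)
    congr 1; ext x; exact norm_sub_rev _ _
  have hGm : ∀ n t, G n t ∈ Ioo (0 : ℝ) 1 := fun n t => by
    have h1 := abs_le.1 (hGF n t)
    have h2 := hF t
    have h3 := (hu n).2
    exact ⟨by linarith [h1.1, h2.1], by linarith [h1.2, h2.2]⟩
  have hGd : ∀ n t, HasDerivAt (G n) (g n t) t := fun n t =>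
    ((hgc n).integral_hasStrictDerivAt 0 t).hasDerivAt.const_add _
  have hGc : ∀ n, Continuous (G n) := fun n =>
    continuous_iff_continuousAt.2 fun t => (hGd n t).continuousAt
  have hGlim : ∀ t, Tendsto (fun n => G n t) atTop (𝓝 (F t)) := fun t => by
    rw [tendsto_iff_norm_sub_tendsto_zero]
    exact squeeze_zero (fun n => norm_nonneg _) (fun n => hGF n t) hu0
  have hIlim : ∀ t, Tendsto (fun n => I (G n t)) atTop (𝓝 (I (F t))) := fun t =>
    (hasDerivAt_I (hF' t)).continuousAt.tendsto.comp (hGlim t)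
  have hVγ := Integrable.gaussianReal hV
  have hiI := integrable_I_comp (P := gaussianReal 0 1) hFc.aemeasurable
  have hiG := fun n => integrable_I_comp (P := gaussianReal 0 1) (hGc n).aemeasurable
  have hkey : ∀ n, I (∫ t, G n t ∂(gaussianReal 0 1)) ≤
      ∫ t, √(I (F t) ^ 2 + V t ^ 2) ∂(gaussianReal 0 1) +
        ∫ t, |I (G n t) - I (F t)| ∂(gaussianReal 0 1) + u n := fun n => by
    obtain ⟨C, hC⟩ := (hgs n).exists_bound_of_continuous (hgc n)
    refine (bobkov_real_of_uniformContinuous (hGm n) (hGd n)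
      ((hgs n).uniformContinuous_of_continuous (hgc n)) hC).trans ?_
    have h1 : ∫ t, |g n t - V t| ∂(gaussianReal 0 1) ≤ u n := by
      refine (integral_gaussianReal_le_integral (fun _ => abs_nonneg _)
        ((hgint n).sub hV).abs).trans (le_trans (le_of_eq ?_) (hgi n))
      congr 1; ext x; exact norm_sub_rev (g n x) _
    refine le_trans ?_ (add_le_add_right h1 _)
    have hgγ := Integrable.gaussianReal (hgint n)
    have i1 := integrable_sqrt_add_sq hiI hVγ
    have i2 := ((hiG n).sub hiI).abs
    have i3 := (hgγ.sub hVγ).abs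
    have e : ∫ t, (√(I (F t) ^ 2 + V t ^ 2) + |I (G n t) - I (F t)| + |g n t - V t|)
        ∂(gaussianReal 0 1) = _ := integral_add (i1.add i2) i3
    have e0 : ∫ t, (√(I (F t) ^ 2 + V t ^ 2) + |I (G n t) - I (F t)|) ∂(gaussianReal 0 1) = _ :=
      integral_add i1 i2
    rw [e0] at e
    refine le_trans (integral_mono (integrable_sqrt_add_sq (hiG n) hgγ) ((i1.add i2).add i3)
      fun t => ?_) e.le
    have h2 := sqrt_add_sq_add_le (I (F t)) (I (G n t) - I (F t)) (V t) (g n t - V t)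
    have h3 : √((I (G n t) - I (F t)) ^ 2 + (g n t - V t) ^ 2) ≤
        |I (G n t) - I (F t)| + |g n t - V t| := by
      refine Real.sqrt_le_iff.2 ⟨by positivity, ?_⟩
      nlinarith [sq_abs (I (G n t) - I (F t)), sq_abs (g n t - V t),
        mul_nonneg (abs_nonneg (I (G n t) - I (F t))) (abs_nonneg (g n t - V t))]
    simp only [add_sub_cancel] at h2
    simp only [Pi.add_apply, Pi.sub_apply]
    linarith
  have hl1 : Tendsto (fun n => ∫ t, G n t ∂(gaussianReal 0 1)) atTop
      (𝓝 (∫ t, F t ∂(gaussianReal 0 1))) := by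
    refine tendsto_integral_of_dominated_convergence (fun _ => 1)
      (fun n => (hGc n).aestronglyMeasurable) (integrable_const _)
      (fun n => Eventually.of_forall fun t => ?_) (Eventually.of_forall hGlim)
    rw [Real.norm_of_nonneg (hGm n t).1.le]; exact (hGm n t).2.le
  have hl2 : Tendsto (fun n => ∫ t, |I (G n t) - I (F t)| ∂(gaussianReal 0 1)) atTop
      (𝓝 (∫ _, (0 : ℝ) ∂(gaussianReal 0 1))) := by
    refine tendsto_integral_of_dominated_convergence (fun _ => 1)
      (fun n => ((hiG n).sub hiI).abs.aestronglyMeasurable) (integrable_const _)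
      (fun n => Eventually.of_forall fun t => ?_) (Eventually.of_forall fun t => ?_)
    · rw [Real.norm_of_nonneg (abs_nonneg _), abs_le]
      constructor <;> linarith [I_nonneg (G n t), I_nonneg (F t), I_le_one (G n t), I_le_one (F t)]
    · simpa using ((hIlim t).sub_const (I (F t))).abs
  have hm := integral_mem_Ioo (P := gaussianReal 0 1) hFc.aestronglyMeasurable hF'
  have hl3 := (hasDerivAt_I hm).continuousAt.tendsto.comp hl1
  have hl4 := (hl2.const_add (∫ t, √(I (F t) ^ 2 + V t ^ 2) ∂(gaussianReal 0 1))).add hu0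
  simp only [integral_zero, add_zero] at hl4
  exact le_of_tendsto_of_tendsto' hl3 hl4 hkey

/-- Truncating the derivative to `(-k, k]` amounts to freezing the function outside `[-k, k]`. -/
lemma integral_indicator_Ioc_eq {V : ℝ → ℝ} {k : ℝ} (hk : 0 ≤ k) (t : ℝ) :
    ∫ x in (0 : ℝ)..t, (Ioc (-k) k).indicator V x =
      ∫ x in (0 : ℝ)..(max (-k) (min k t)), V x := by
  rcases le_total 0 t with ht | ht
  · have h0 : 0 ≤ max (-k) (min k t) := le_max_of_le_right (le_min hk ht)
    rw [intervalIntegral.integral_of_le ht, intervalIntegral.integral_of_le h0,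
      setIntegral_indicator measurableSet_Ioc, Ioc_inter_Ioc]
    congr 3
    · simp [hk]
    · rw [max_eq_right (by linarith [le_min hk ht]), inf_comm]
  · have h0 : max (-k) (min k t) ≤ 0 := max_le (by linarith) (min_le_of_right_le ht)
    rw [intervalIntegral.integral_of_ge ht, intervalIntegral.integral_of_ge h0,
      setIntegral_indicator measurableSet_Ioc, Ioc_inter_Ioc]
    congr 4
    · rw [min_eq_right (by linarith), sup_comm]
    · simp [hk]

/-- Bobkov's inequality on the line for a function with Gaussian-integrable weak derivative. -/
theorem bobkov_real {F V : ℝ → ℝ} (hF : ∀ t, F t ∈ Ioo (0 : ℝ) 1)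
    (hV : Integrable V (gaussianReal 0 1)) (hd : ∀ t, F t = F 0 + ∫ x in (0 : ℝ)..t, V x) :
    I (∫ t, F t ∂(gaussianReal 0 1)) ≤ ∫ t, √(I (F t) ^ 2 + V t ^ 2) ∂(gaussianReal 0 1) := by
  have hVi := intervalIntegrable_of_integrable_gaussianReal hV
  have hFc : Continuous F := by
    rw [funext hd]
    exact continuous_const.add (intervalIntegral.continuous_primitive hVi 0)
  -- Freezing `F` outside `[-k, k]` confines its values to a compact subset of `(0, 1)` and makes
  -- the derivative Lebesgue integrable.
  set c : ℕ → ℝ → ℝ := fun k t => max (-(k : ℝ)) (min k t) with hc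
  have hcc : ∀ k, Continuous (c k) := fun k => by fun_prop
  have hc0 : ∀ k, c k 0 = 0 := fun k => by simp [hc]
  have hck : ∀ t, ∀ᶠ k : ℕ in atTop, c k t = t ∧ t ∈ Ioc (-(k : ℝ)) k := fun t => by
    filter_upwards [eventually_gt_atTop ⌈|t|⌉₊] with k hk
    have h1 : |t| < k := (Nat.le_ceil _).trans_lt (Nat.cast_lt.2 hk)
    have h2 := abs_lt.1 h1
    refine ⟨?_, h2.1, h2.2.le⟩
    simp only [hc, min_eq_right h2.2.le, max_eq_right h2.1.le]
  set W : ℕ → ℝ → ℝ := fun k => (Ioc (-(k : ℝ)) k).indicator V with hW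
  have hWle : ∀ k t, |W k t| ≤ |V t| := fun k t => norm_indicator_le_norm_self V t
  have hWγ : ∀ k, Integrable (W k) (gaussianReal 0 1) := fun k => hV.indicator measurableSet_Ioc
  have hkey : ∀ k, I (∫ t, F (c k t) ∂(gaussianReal 0 1)) ≤
      ∫ t, √(I (F (c k t)) ^ 2 + W k t ^ 2) ∂(gaussianReal 0 1) := fun k => by
    have hk : -(k : ℝ) ≤ k := by linarith [Nat.cast_nonneg (α := ℝ) k]
    obtain ⟨x₁, -, h1⟩ := isCompact_Icc.exists_isMinOn (nonempty_Icc.2 hk) hFc.continuousOn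
    obtain ⟨x₂, -, h2⟩ := isCompact_Icc.exists_isMaxOn (nonempty_Icc.2 hk) hFc.continuousOn
    have hmem : ∀ t, c k t ∈ Icc (-(k : ℝ)) k := fun t =>
      ⟨le_max_left _ _, max_le hk (min_le_left _ _)⟩
    refine bobkov_real_of_integrable (η := min (F x₁) (1 - F x₂))
      (lt_min (hF x₁).1 (sub_pos.2 (hF x₂).2)) (fun t => ⟨?_, ?_⟩) ?_ (fun t => ?_)
    · exact (min_le_left _ _).trans (h1 (hmem t))
    · have h3 : F (c k t) ≤ F x₂ := h2 (hmem t)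
      linarith [min_le_right (F x₁) (1 - F x₂)]
    · rw [hW, integrable_indicator_iff measurableSet_Ioc, ← uIoc_of_le hk]
      exact intervalIntegrable_iff.1 (hVi _ _)
    · rw [integral_indicator_Ioc_eq (Nat.cast_nonneg k), hc0]
      exact hd _
  have hm := integral_mem_Ioo (P := gaussianReal 0 1) hFc.aestronglyMeasurable hF
  have hl1 : Tendsto (fun k => ∫ t, F (c k t) ∂(gaussianReal 0 1)) atTop
      (𝓝 (∫ t, F t ∂(gaussianReal 0 1))) := by
    refine tendsto_integral_of_dominated_convergence (fun _ => 1)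
      (fun k => (hFc.comp (hcc k)).aestronglyMeasurable) (integrable_const _)
      (fun k => Eventually.of_forall fun t => ?_) (Eventually.of_forall fun t => ?_)
    · rw [Real.norm_of_nonneg (hF _).1.le]; exact (hF _).2.le
    · refine tendsto_const_nhds.congr' ?_
      filter_upwards [hck t] with k hk
      rw [hk.1]
  have hI := fun k => integrable_I_comp (P := gaussianReal 0 1)
    (hFc.comp (hcc k)).aemeasurable
  have hl2 : Tendsto (fun k => ∫ t, √(I (F (c k t)) ^ 2 + W k t ^ 2) ∂(gaussianReal 0 1)) atTop
      (𝓝 (∫ t, √(I (F t) ^ 2 + V t ^ 2) ∂(gaussianReal 0 1))) := by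
    refine tendsto_integral_of_dominated_convergence (fun t => 1 + |V t|)
      (fun k => (integrable_sqrt_add_sq (hI k) (hWγ k)).aestronglyMeasurable)
      ((integrable_const _).add hV.abs)
      (fun k => Eventually.of_forall fun t => ?_) (Eventually.of_forall fun t => ?_)
    · rw [Real.norm_of_nonneg (Real.sqrt_nonneg _)]
      refine Real.sqrt_le_iff.2 ⟨by positivity, ?_⟩
      have h1 := sq_le_sq.2 (hWle k t)
      have h2 := pow_le_pow_left₀ (I_nonneg (F (c k t))) (I_le_one _) 2
      nlinarith [abs_nonneg (V t), sq_abs (V t)]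
    · refine tendsto_const_nhds.congr' ?_
      filter_upwards [hck t] with k hk
      rw [hk.1, hW]
      simp only [indicator_of_mem hk.2]
  exact le_of_tendsto_of_tendsto' ((hasDerivAt_I hm).continuousAt.tendsto.comp hl1) hl2 hkey

/-! ### Mixtures and induction on the dimension. -/

/-- Bobkov's inequality on the line for a mixture of differentiable functions. -/
theorem bobkov_real_mixture {Ω : Type*} [MeasurableSpace Ω] {P : Measure Ω}
    [IsProbabilityMeasure P] {G D : ℝ → Ω → ℝ} (hG : ∀ t ω, G t ω ∈ Ioo (0 : ℝ) 1)
    (hGm : ∀ t, Measurable (G t)) (hd : ∀ t ω, HasDerivAt (fun s => G s ω) (D t ω) t)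
    (hDc : ∀ ω, Continuous fun t => D t ω)
    (hDi : Integrable (Function.uncurry D) ((gaussianReal 0 1).prod P)) :
    I (∫ t, ∫ ω, G t ω ∂P ∂(gaussianReal 0 1)) ≤
      ∫ t, √(I (∫ ω, G t ω ∂P) ^ 2 + (∫ ω, D t ω ∂P) ^ 2) ∂(gaussianReal 0 1) := by
  have hGi : ∀ t, Integrable (G t) P := fun t =>
    Integrable.of_bound (hGm t).aestronglyMeasurable 1 (Eventually.of_forall fun ω => by
      rw [Real.norm_of_nonneg (hG t ω).1.le]; exact (hG t ω).2.le)
  refine bobkov_real (fun t => integral_mem_Ioo (hGm t).aestronglyMeasurable (hG t))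
    hDi.integral_prod_left fun t => ?_
  obtain ⟨C, hC⟩ := exists_restrict_uIoc_le_smul_gaussianReal 0 t
  -- Fubini and the fundamental theorem of calculus for each `ω` show that `∫ D` is the weak
  -- derivative of `∫ G`, without differentiating under the integral.
  rw [intervalIntegral_integral_swap, ← sub_eq_iff_eq_add', ← integral_sub (hGi t) (hGi 0)]
  · refine integral_congr_ae (Eventually.of_forall fun ω => ?_)
    exact (intervalIntegral.integral_eq_sub_of_hasDerivAt (fun x _ => hd x ω)
      ((hDc ω).intervalIntegrable _ _)).symm
  · have h1 : (volume.restrict (uIoc 0 t)).prod P ≤ (C • gaussianReal 0 1).prod P :=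
      Measure.prod_mono hC le_rfl
    refine Integrable.mono_measure ?_ h1
    rw [Measure.prod_smul_left]
    exact hDi.smul_measure_nnreal

lemma integrable_sqrt_add_sum_sq {Ω ι : Type*} [MeasurableSpace Ω] {P : Measure Ω} {a : Ω → ℝ}
    {b : ι → Ω → ℝ} (s : Finset ι) (ha : Integrable a P) (hb : ∀ i, Integrable (b i) P) :
    Integrable (fun ω => √(a ω ^ 2 + ∑ i ∈ s, b i ω ^ 2)) P := by
  classical
  induction s using Finset.induction_on with
  | empty => simpa [Real.sqrt_sq_eq_abs] using ha.abs
  | insert i s hi ih =>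
    refine (integrable_sqrt_add_sq ih (hb i)).congr (Eventually.of_forall fun ω => ?_)
    simp only
    rw [Real.sq_sqrt (by positivity), Finset.sum_insert hi]
    ring_nf

/-- The embedding `y ↦ (0, y)` of `ℝⁿ` into `ℝⁿ⁺¹`. -/
noncomputable def consZero (n : ℕ) : (Fin n → ℝ) →L[ℝ] (Fin (n + 1) → ℝ) :=
  ContinuousLinearMap.pi (Fin.cons 0 fun i => ContinuousLinearMap.proj i)

lemma cons_eq {n : ℕ} (t : ℝ) (y : Fin n → ℝ) :
    (Fin.cons t y : Fin (n + 1) → ℝ) = t • Pi.single 0 1 + consZero n y := by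
  ext i
  refine Fin.cases ?_ (fun j => ?_) i <;> simp [consZero]

lemma consZero_single {n : ℕ} (i : Fin n) :
    consZero n (Pi.single i 1) = Pi.single i.succ 1 := by
  ext j
  refine Fin.cases ?_ (fun j => ?_) j
  · simp [consZero]
  · simp [consZero, Pi.single_apply]

section Cons

variable {n : ℕ} {f : (Fin (n + 1) → ℝ) → ℝ}

lemma hasDerivAt_comp_cons (hf : Differentiable ℝ f) (t : ℝ) (y : Fin n → ℝ) :
    HasDerivAt (fun s => f (Fin.cons s y)) (fderiv ℝ f (Fin.cons t y) (Pi.single 0 1)) t := by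
  have h1 : HasDerivAt (fun s : ℝ => (Fin.cons s y : Fin (n + 1) → ℝ)) (Pi.single 0 1) t := by
    simp only [cons_eq]
    simpa using ((hasDerivAt_id t).smul_const (Pi.single 0 1)).add_const (consZero n y)
  exact (hf _).hasFDerivAt.comp_hasDerivAt t h1

lemma hasFDerivAt_comp_cons (hf : Differentiable ℝ f) (t : ℝ) (y : Fin n → ℝ) :
    HasFDerivAt (fun z => f (Fin.cons t z)) ((fderiv ℝ f (Fin.cons t y)).comp (consZero n)) y := by
  have h1 : HasFDerivAt (fun z : Fin n → ℝ => (Fin.cons t z : Fin (n + 1) → ℝ)) (consZero n) y := by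
    simp only [cons_eq]
    exact (consZero n).hasFDerivAt.const_add _
  exact (hf _).hasFDerivAt.comp y h1

lemma contDiff_comp_cons (hf : ContDiff ℝ 1 f) (t : ℝ) :
    ContDiff ℝ 1 fun z : Fin n → ℝ => f (Fin.cons t z) := by
  simp only [cons_eq]
  exact hf.comp (contDiff_const.add (consZero n).contDiff)

lemma measurePreserving_cons (n : ℕ) :
    MeasurePreserving (fun p : ℝ × (Fin n → ℝ) => (Fin.cons p.1 p.2 : Fin (n + 1) → ℝ))
      ((gaussianReal 0 1).prod (Measure.pi fun _ => gaussianReal 0 1))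
      (Measure.pi fun _ => gaussianReal 0 1) := by
  have := (measurePreserving_piFinSuccAbove (fun _ : Fin (n + 1) => gaussianReal 0 1) 0).symm
  convert! this using 1
  ext p
  simp [MeasurableEquiv.piFinSuccAbove, Fin.insertNthEquiv]

end Cons

/-- Bobkov's inequality on `ℝⁿ`, in coordinates. -/
theorem bobkov_pi {n : ℕ} {f : (Fin n → ℝ) → ℝ} (hf : ContDiff ℝ 1 f)
    (hm : ∀ x, f x ∈ Ioo (0 : ℝ) 1)
    (hi : ∀ i, Integrable (fun x => fderiv ℝ f x (Pi.single i 1))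
      (Measure.pi fun _ => gaussianReal 0 1)) :
    I (∫ x, f x ∂(Measure.pi fun _ => gaussianReal 0 1)) ≤
      ∫ x, √(I (f x) ^ 2 + ∑ i, fderiv ℝ f x (Pi.single i 1) ^ 2)
        ∂(Measure.pi fun _ => gaussianReal 0 1) := by
  induction n with
  | zero =>
    simp only [Finset.univ_eq_empty, Finset.sum_empty, add_zero, Real.sqrt_sq (I_nonneg _)]
    rw [integral_unique, integral_unique]
    simp
  | succ n ih =>
    have hfd := hf.differentiable one_ne_zero
    have hfc := hf.continuous
    have hfd' : Continuous (fderiv ℝ f) := hf.continuous_fderiv one_ne_zero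
    have hmp := measurePreserving_cons n
    have hcc : Continuous fun p : ℝ × (Fin n → ℝ) => (Fin.cons p.1 p.2 : Fin (n + 1) → ℝ) := by
      simp only [cons_eq]; fun_prop
    have hemb : MeasurableEmbedding
        fun p : ℝ × (Fin n → ℝ) => (Fin.cons p.1 p.2 : Fin (n + 1) → ℝ) := by
      convert! (MeasurableEquiv.piFinSuccAbove (fun _ : Fin (n + 1) => ℝ) 0).symm.measurableEmbedding
        using 1
      ext p
      simp [MeasurableEquiv.piFinSuccAbove, Fin.insertNthEquiv]
    set μ : Measure (Fin n → ℝ) := Measure.pi fun _ => gaussianReal 0 1 with hμ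
    set D : Fin (n + 1) → ℝ → (Fin n → ℝ) → ℝ :=
      fun i t y => fderiv ℝ f (Fin.cons t y) (Pi.single i 1) with hD
    have hDi : ∀ i, Integrable (Function.uncurry (D i)) ((gaussianReal 0 1).prod μ) := fun i =>
      (hmp.integrable_comp_emb hemb).2 (hi i)
    have hmix := bobkov_real_mixture (P := μ) (G := fun t y => f (Fin.cons t y)) (D := D 0)
      (fun t y => hm _) (fun t => (contDiff_comp_cons hf t).continuous.measurable)
      (fun t y => hasDerivAt_comp_cons hfd t y)
      (fun y => by
        have : Continuous fun t : ℝ => (Fin.cons t y : Fin (n + 1) → ℝ) :=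
          hcc.comp (by fun_prop : Continuous fun t : ℝ => (t, y))
        exact (hfd'.comp this).clm_apply continuous_const) (hDi 0)
    have hIi : Integrable (fun p : ℝ × (Fin n → ℝ) => I (f (Fin.cons p.1 p.2)))
        ((gaussianReal 0 1).prod μ) :=
      integrable_I_comp (hfc.comp hcc).aemeasurable
    have hfull : Integrable (fun p : ℝ × (Fin n → ℝ) =>
        √(I (f (Fin.cons p.1 p.2)) ^ 2 + ∑ i, D i p.1 p.2 ^ 2)) ((gaussianReal 0 1).prod μ) :=
      integrable_sqrt_add_sum_sq Finset.univ hIi hDi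
    have hfi : Integrable (fun p : ℝ × (Fin n → ℝ) => f (Fin.cons p.1 p.2))
        ((gaussianReal 0 1).prod μ) :=
      Integrable.of_bound (hfc.comp hcc).aestronglyMeasurable 1 (Eventually.of_forall fun p => by
        rw [Real.norm_of_nonneg (hm _).1.le]; exact (hm _).2.le)
    rw [← hmp.integral_comp hemb, ← hmp.integral_comp hemb, integral_prod _ hfi,
      integral_prod _ hfull]
    -- `hmix` is the line inequality for the marginal in `t`. It remains to bound its integrand for
    -- almost every `t`, namely where the slice derivatives are integrable.
    refine hmix.trans (integral_mono_ae (integrable_sqrt_add_sq (integrable_I_comp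
      hfi.integral_prod_left.aestronglyMeasurable.aemeasurable) (hDi 0).integral_prod_left)
      hfull.integral_prod_left ?_)
    filter_upwards [ae_all_iff.2 fun i => (hDi i).prod_right_ae] with t ht
    have hfdt : ∀ y (i : Fin n), fderiv ℝ (fun z : Fin n → ℝ => f (Fin.cons t z)) y
        (Pi.single i 1) = D i.succ t y := fun y i => by
      rw [(hasFDerivAt_comp_cons hfd t y).fderiv, ContinuousLinearMap.comp_apply, consZero_single]
    have h1 := ih (contDiff_comp_cons hf t) (fun y => hm _)
      (fun i => by simp only [hfdt]; exact ht i.succ)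
    simp only [hfdt] at h1
    have hS : Integrable (fun y => √(I (f (Fin.cons t y)) ^ 2 + ∑ i : Fin n, D i.succ t y ^ 2)) μ :=
      integrable_sqrt_add_sum_sq Finset.univ
        (integrable_I_comp (contDiff_comp_cons hf t).continuous.aemeasurable) fun i => ht i.succ
    calc √(I (∫ y, f (Fin.cons t y) ∂μ) ^ 2 + (∫ y, D 0 t y ∂μ) ^ 2)
        ≤ √((∫ y, √(I (f (Fin.cons t y)) ^ 2 + ∑ i : Fin n, D i.succ t y ^ 2) ∂μ) ^ 2 +
            (∫ y, D 0 t y ∂μ) ^ 2) :=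
          Real.sqrt_le_sqrt (add_le_add_left (pow_le_pow_left₀ (I_nonneg _) h1 2) _)
      _ ≤ ∫ y, √(√(I (f (Fin.cons t y)) ^ 2 + ∑ i : Fin n, D i.succ t y ^ 2) ^ 2 +
            D 0 t y ^ 2) ∂μ := sqrt_integral_sq_add_le hS (ht 0)
      _ = ∫ y, √(I (f (Fin.cons t y)) ^ 2 + ∑ i, D i t y ^ 2) ∂μ := by
          congr 1
          ext y
          rw [Real.sq_sqrt (by positivity), Fin.sum_univ_succ]
          ring_nf

section FiniteDimensional

variable {E : Type*} [NormedAddCommGroup E] [InnerProductSpace ℝ E] [FiniteDimensional ℝ E]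
  [MeasurableSpace E] [BorelSpace E]

/-- Bobkov's inequality for the standard Gaussian measure on a Euclidean space. -/
theorem bobkov_stdGaussian {f : E → ℝ} (hf : ContDiff ℝ 1 f) (hm : ∀ x, f x ∈ Ioo (0 : ℝ) 1)
    (hi : Integrable (fun x => ‖fderiv ℝ f x‖) (stdGaussian E)) :
    I (∫ x, f x ∂(stdGaussian E)) ≤
      ∫ x, √(I (f x) ^ 2 + ‖fderiv ℝ f x‖ ^ 2) ∂(stdGaussian E) := by
  have hfc := hf.continuous
  have hfd := hf.differentiable one_ne_zero
  have hfd' : Continuous (fderiv ℝ f) := hf.continuous_fderiv one_ne_zero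
  have hIf : Continuous fun t => I (f t) := continuousOn_I.comp_continuous hfc hm
  set b := stdOrthonormalBasis ℝ E
  let T : (Fin (Module.finrank ℝ E) → ℝ) →L[ℝ] E :=
    ∑ i, (ContinuousLinearMap.proj i : (Fin (Module.finrank ℝ E) → ℝ) →L[ℝ] ℝ).smulRight (b i)
  have hT : ∀ x, T x = ∑ i, x i • b i := fun x => by
    simp [T]
  have hTs : ∀ i, T (Pi.single i 1) = b i := fun i => by
    simp [hT, Pi.single_apply]
  have hmap : stdGaussian E = (Measure.pi fun _ => gaussianReal 0 1).map T := by
    rw [stdGaussian]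
    congr 1
    ext x
    exact (hT x).symm
  have hTm : AEMeasurable T (Measure.pi fun _ => gaussianReal 0 1) :=
    T.continuous.aemeasurable
  have hfderiv : ∀ x i, fderiv ℝ (fun x => f (T x)) x (Pi.single i 1) = fderiv ℝ f (T x) (b i) :=
    fun x i => by
      have : HasFDerivAt (fun x => f (T x)) ((fderiv ℝ f (T x)).comp T) x :=
        (hfd _).hasFDerivAt.comp x T.hasFDerivAt
      rw [this.fderiv, ContinuousLinearMap.comp_apply, hTs]
  have hnorm : ∀ x, ∑ i, fderiv ℝ f x (b i) ^ 2 = ‖fderiv ℝ f x‖ ^ 2 := fun x =>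
    (b.norm_dual _).symm
  rw [hmap, integrable_map_measure (by fun_prop) hTm] at hi
  rw [hmap, integral_map hTm (by fun_prop), integral_map hTm (by fun_prop)]
  have := bobkov_pi (f := fun x => f (T x)) (hf.comp T.contDiff) (fun x => hm _) (fun i => by
    simp only [hfderiv]
    refine hi.mono' (by fun_prop) (Eventually.of_forall fun x => ?_)
    simpa [b.norm_eq_one] using (fderiv ℝ f (T x)).le_opNorm (b i))
  simpa only [hfderiv, hnorm] using this

end FiniteDimensional

/-! ### The rotation `mix` and the rigidity of equality. -/

section InnerProductSpace

variable {E : Type*} [NormedAddCommGroup E] [InnerProductSpace ℝ E]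

/-- The contraction by `4/5` in the direction `e`. -/
noncomputable def contract (e : E) : E →L[ℝ] E :=
  ContinuousLinearMap.id ℝ E - (1 / 5 : ℝ) • (innerSL ℝ e).smulRight e

lemma contract_apply (e z : E) : contract e z = z - (1 / 5 * inner ℝ e z) • e := by
  simp [contract, smul_smul]

lemma inner_contract_left (e z ξ : E) : inner ℝ (contract e z) ξ = inner ℝ z (contract e ξ) := by
  simp only [contract_apply, inner_sub_left, inner_sub_right, inner_smul_left, inner_smul_right]
  rw [real_inner_comm z e]
  simp; ring

lemma norm_sq_contract {e : E} (he : ‖e‖ = 1) (z : E) :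
    ‖contract e z‖ ^ 2 = ‖z‖ ^ 2 - (3 / 5 * inner ℝ e z) ^ 2 := by
  rw [contract_apply, norm_sub_sq_real, inner_smul_right, norm_smul, he, real_inner_comm z e,
    Real.norm_eq_abs, mul_one, sq_abs]
  ring

/-- With `L` the derivative of `f` at `mix e t z`, the summands are the squared `z`-gradient and
`t`-derivative of `f (mix e t z)`. Since `(4/5)² + (3/5)² = 1`, the full gradient keeps its length.
-/
lemma norm_sq_comp_contract [CompleteSpace E] {e : E} (he : ‖e‖ = 1) (L : StrongDual ℝ E) :
    ‖L.comp (contract e)‖ ^ 2 + (3 / 5 * L e) ^ 2 = ‖L‖ ^ 2 := by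
  obtain ⟨u, rfl⟩ := (InnerProductSpace.toDual ℝ E).surjective L
  have h : (InnerProductSpace.toDual ℝ E u : StrongDual ℝ E).comp (contract e) =
      InnerProductSpace.toDual ℝ E (contract e u) := by
    ext z
    simp [inner_contract_left]
  rw [h, LinearIsometryEquiv.norm_map, LinearIsometryEquiv.norm_map, norm_sq_contract he,
    InnerProductSpace.toDual_apply_apply, real_inner_comm]
  ring

/-- A rotation of the Gaussian measure mixing an independent Gaussian into the direction `e`. -/
noncomputable def mix (e : E) (t : ℝ) (z : E) : E := contract e z + (3 / 5 * t) • e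

lemma continuous_mix (e : E) : Continuous (Function.uncurry (mix e)) := by
  unfold mix Function.uncurry; fun_prop

/-- The preimage solves `y_e = 4/5 z_e + 3/5 t`, that is `z_e = 5/4 y_e - 3/4 t`. Through this,
information at a single `t` covers all of `E`. -/
lemma mix_surjective {e : E} (he : ‖e‖ = 1) (t : ℝ) : Function.Surjective (mix e t) := by
  intro y
  have hee : inner ℝ e e = (1 : ℝ) := by rw [real_inner_self_eq_norm_sq, he, one_pow]
  refine ⟨y + (1 / 4 * inner ℝ e y - 3 / 4 * t) • e, ?_⟩
  rw [mix, contract_apply, inner_add_right, inner_smul_right, hee]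
  module

end InnerProductSpace

section FiniteDimensional

variable {E : Type*} [NormedAddCommGroup E] [InnerProductSpace ℝ E] [FiniteDimensional ℝ E]
  [MeasurableSpace E] [BorelSpace E]

instance : Measure.IsOpenPosMeasure (gaussianReal 0 1) :=
  (gaussianReal_absolutelyContinuous' 0 one_ne_zero).isOpenPosMeasure

instance : Measure.IsOpenPosMeasure (stdGaussian E) := by
  rw [stdGaussian]
  refine Continuous.isOpenPosMeasure_map (by fun_prop) fun y =>
    ⟨fun i => (stdOrthonormalBasis ℝ E).repr y i, (stdOrthonormalBasis ℝ E).sum_repr y⟩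

lemma measurePreserving_mix {e : E} (he : ‖e‖ = 1) :
    MeasurePreserving (Function.uncurry (mix e)) ((gaussianReal 0 1).prod (stdGaussian E))
      (stdGaussian E) := by
  refine ⟨(continuous_mix e).measurable, Measure.ext_of_charFun ?_⟩
  ext ξ
  rw [charFun_apply, integral_map (continuous_mix e).measurable.aemeasurable (by fun_prop)]
  have h : ∀ p : ℝ × E, Complex.exp (inner ℝ (Function.uncurry (mix e) p) ξ * Complex.I) =
      Complex.exp ((3 / 5 * inner ℝ e ξ : ℝ) * p.1 * Complex.I) *
        Complex.exp (inner ℝ p.2 (contract e ξ) * Complex.I) := fun p => by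
    rw [← Complex.exp_add, Function.uncurry, mix, inner_add_left, inner_contract_left,
      inner_smul_left]
    congr 1
    simp
    ring
  simp only [h]
  rw [integral_prod_mul (fun t : ℝ => Complex.exp ((3 / 5 * inner ℝ e ξ : ℝ) * t * Complex.I))
    (fun z : E => Complex.exp (inner ℝ z (contract e ξ) * Complex.I)), ← charFun_apply_real,
    ← charFun_apply, charFun_gaussianReal, charFun_stdGaussian, charFun_stdGaussian,
    ← Complex.exp_add]
  congr 1
  have h2 : (‖contract e ξ‖ : ℂ) ^ 2 = (‖ξ‖ : ℂ) ^ 2 - (3 / 5 * inner ℝ e ξ : ℝ) ^ 2 := by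
    exact_mod_cast norm_sq_contract he ξ
  rw [h2]
  simp
  ring

/-- Equality in Bobkov's inequality forces each directional derivative to be proportional to the
integrand. -/
theorem exists_fderiv_eq_mul_sqrt {f : E → ℝ} (hf : ContDiff ℝ 1 f)
    (hm : ∀ x, f x ∈ Ioo (0 : ℝ) 1) (hi : Integrable (fun x => ‖fderiv ℝ f x‖) (stdGaussian E))
    (heq : ∫ x, √(I (f x) ^ 2 + ‖fderiv ℝ f x‖ ^ 2) ∂(stdGaussian E) ≤
      I (∫ x, f x ∂(stdGaussian E))) {e : E} (he : ‖e‖ = 1) :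
    ∃ w : ℝ, ∀ y, fderiv ℝ f y e = w * √(I (f y) ^ 2 + ‖fderiv ℝ f y‖ ^ 2) := by
  have hfc := hf.continuous
  have hfd := hf.differentiable one_ne_zero
  have hfd' : Continuous (fderiv ℝ f) := hf.continuous_fderiv one_ne_zero
  have hIf : Continuous fun x => I (f x) := continuousOn_I.comp_continuous hfc hm
  have hmp := measurePreserving_mix he
  have hmt : ∀ t, Continuous (mix e t) := fun t => by unfold mix; fun_prop
  have hmz : ∀ z, Continuous fun t => mix e t z := fun z => by unfold mix; fun_prop
  have hiI : Integrable (fun x => I (f x)) (stdGaussian E) := integrable_I_comp hfc.aemeasurable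
  have hiJ := integrable_sqrt_add_sq hiI hi
  have hie : Integrable (fun x => fderiv ℝ f x e) (stdGaussian E) := by
    refine hi.mono' (by fun_prop) (Eventually.of_forall fun x => ?_)
    simpa [he] using (fderiv ℝ f x).le_opNorm e
  have hif : Integrable f (stdGaussian E) :=
    Integrable.of_bound hfc.aestronglyMeasurable 1 (Eventually.of_forall fun x => by
      rw [Real.norm_of_nonneg (hm x).1.le]; exact (hm x).2.le)
  set J : E → ℝ := fun x => √(I (f x) ^ 2 + ‖fderiv ℝ f x‖ ^ 2) with hJ
  have hJc : Continuous J := by fun_prop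
  set a : ℝ → E → ℝ := fun t z =>
    √(I (f (mix e t z)) ^ 2 + ‖(fderiv ℝ f (mix e t z)).comp (contract e)‖ ^ 2) with ha
  set b : ℝ → E → ℝ := fun t z => 3 / 5 * fderiv ℝ f (mix e t z) e with hb
  have hab : ∀ t z, √(a t z ^ 2 + b t z ^ 2) = J (mix e t z) := fun t z => by
    simp only [ha, hb, hJ]
    rw [Real.sq_sqrt (by positivity), add_assoc, norm_sq_comp_contract he]
  have hac : ∀ t, Continuous (a t) := fun t => by
    have := ((hfd'.comp (hmt t)).clm_comp (continuous_const (y := contract e))).norm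
    exact Real.continuous_sqrt.comp (((hIf.comp (hmt t)).pow 2).add (this.pow 2))
  have hbc : ∀ t, Continuous (b t) := fun t => by simp only [hb]; fun_prop
  have hbi : Integrable (Function.uncurry b) ((gaussianReal 0 1).prod (stdGaussian E)) :=
    (hmp.integrable_comp_of_integrable hie).const_mul (3 / 5)
  have hJi : Integrable (fun p : ℝ × E => J (mix e p.1 p.2))
      ((gaussianReal 0 1).prod (stdGaussian E)) := hmp.integrable_comp_of_integrable hiJ
  have hfi : Integrable (fun p : ℝ × E => f (mix e p.1 p.2))
      ((gaussianReal 0 1).prod (stdGaussian E)) := hmp.integrable_comp_of_integrable hif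
  have hmix := bobkov_real_mixture (P := stdGaussian E) (G := fun t z => f (mix e t z)) (D := b)
    (fun t z => hm _) (fun t => (hfc.comp (hmt t)).measurable)
    (fun t z => by
      have h1 : HasDerivAt (fun s => mix e s z) ((3 / 5 : ℝ) • e) t := by
        unfold mix
        simpa using (((hasDerivAt_id t).const_mul (3 / 5 : ℝ)).smul_const e).const_add (contract e z)
      have := (hfd (mix e t z)).hasFDerivAt.comp_hasDerivAt t h1
      simpa [hb, Function.comp_def] using this)
    (fun z => continuous_const.mul ((hfd'.comp (hmz z)).clm_apply (continuous_const (y := e)))) hbi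
  have hIF : ∀ t, Integrable (a t) (stdGaussian E) →
      I (∫ z, f (mix e t z) ∂(stdGaussian E)) ≤ ∫ z, a t z ∂(stdGaussian E) := fun t ht => by
    have hd : ∀ z, fderiv ℝ (fun z => f (mix e t z)) z =
        (fderiv ℝ f (mix e t z)).comp (contract e) := fun z => by
      have h1 : HasFDerivAt (mix e t) (contract e) z :=
        (contract e).hasFDerivAt.add_const ((3 / 5 * t) • e)
      exact ((hfd (mix e t z)).hasFDerivAt.comp z h1).fderiv
    have h1 : ContDiff ℝ 1 fun z => f (mix e t z) :=
      hf.comp ((contract e).contDiff.add contDiff_const)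
    have := bobkov_stdGaussian h1 (fun z => hm _) (ht.mono'
      (h1.continuous_fderiv one_ne_zero).norm.aestronglyMeasurable
      (Eventually.of_forall fun z => by
        rw [norm_norm, hd]
        exact Real.le_sqrt_of_sq_le (le_add_of_nonneg_left (sq_nonneg _))))
    simpa only [hd] using this
  have hae : ∀ᵐ t ∂(gaussianReal 0 1), Integrable (a t) (stdGaussian E) ∧
      Integrable (b t) (stdGaussian E) := by
    filter_upwards [hJi.prod_right_ae, hbi.prod_right_ae] with t h1 h2
    refine ⟨h1.mono' (hac t).aestronglyMeasurable (Eventually.of_forall fun z => ?_), h2⟩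
    rw [Real.norm_of_nonneg (Real.sqrt_nonneg _), ← hab]
    exact Real.le_sqrt_of_sq_le (le_add_of_nonneg_right (sq_nonneg _))
  set L : ℝ → ℝ := fun t =>
    √(I (∫ z, f (mix e t z) ∂(stdGaussian E)) ^ 2 + (∫ z, b t z ∂(stdGaussian E)) ^ 2) with hL
  have hL1 : ∀ t, Integrable (a t) (stdGaussian E) →
      L t ≤ √((∫ z, a t z ∂(stdGaussian E)) ^ 2 + (∫ z, b t z ∂(stdGaussian E)) ^ 2) :=
    fun t ht => Real.sqrt_le_sqrt
      (add_le_add_left (pow_le_pow_left₀ (I_nonneg _) (hIF t ht) 2) _)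
  have hLi : Integrable L (gaussianReal 0 1) := integrable_sqrt_add_sq
    (integrable_I_comp hfi.integral_prod_left.aestronglyMeasurable.aemeasurable)
    hbi.integral_prod_left
  have hRi : Integrable (fun t => ∫ z, J (mix e t z) ∂(stdGaussian E)) (gaussianReal 0 1) :=
    hJi.integral_prod_left
  have hLR : ∀ᵐ t ∂(gaussianReal 0 1), 0 ≤ ∫ z, J (mix e t z) ∂(stdGaussian E) - L t := by
    filter_upwards [hae] with t ht
    have h2 := sqrt_integral_sq_add_le ht.1 ht.2
    simp only [hab] at h2
    exact sub_nonneg.2 ((hL1 t ht.1).trans h2)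
  have hRint : ∫ t, ∫ z, J (mix e t z) ∂(stdGaussian E) ∂(gaussianReal 0 1) =
      ∫ x, J x ∂(stdGaussian E) := by
    rw [← integral_prod _ hJi]
    conv_rhs => rw [← hmp.map_eq, integral_map hmp.aemeasurable hJc.aestronglyMeasurable]
    rfl
  have hFint : ∫ t, ∫ z, f (mix e t z) ∂(stdGaussian E) ∂(gaussianReal 0 1) =
      ∫ x, f x ∂(stdGaussian E) := by
    rw [← integral_prod _ hfi]
    conv_rhs => rw [← hmp.map_eq, integral_map hmp.aemeasurable hfc.aestronglyMeasurable]
    rfl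
  -- The chain `I(∫ f) ≤ ∫ L ≤ ∫ J ≤ I(∫ f)` closes up, the last inequality being `heq`.
  have hzero : ∫ t, (∫ z, J (mix e t z) ∂(stdGaussian E) - L t) ∂(gaussianReal 0 1) = 0 := by
    refine le_antisymm ?_ (integral_nonneg_of_ae hLR)
    rw [integral_sub hRi hLi, hRint, sub_nonpos]
    exact heq.trans (hFint ▸ hmix)
  obtain ⟨t, ⟨hat, hbt⟩, ht⟩ := (hae.and
    ((integral_eq_zero_iff_of_nonneg_ae hLR (hRi.sub hLi)).1 hzero)).exists
  have hprop := ae_eq_of_integral_sqrt_le hat hbt (by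
    simp only [hab]
    exact (sub_eq_zero.1 ht).le.trans (hL1 t hat))
  set A := ∫ z, a t z ∂(stdGaussian E)
  set B := ∫ z, b t z ∂(stdGaussian E)
  -- Both sides are continuous and the Gaussian measure charges every nonempty open set, so the
  -- proportionality holds everywhere.
  have hall := (Continuous.ae_eq_iff_eq (stdGaussian E) (continuous_const.mul (hbc t))
    (continuous_const.mul (hac t))).1 hprop
  have hA : 0 < A := (I_pos (integral_mem_Ioo (hfc.comp (hmt t)).aestronglyMeasurable
    fun z => hm _)).trans_le (hIF t hat)
  -- From `b = (B/A) a` one gets `J = √(1 + (B/A)²) a`; the factor `5/3` undoes the `3/5` in `b`.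
  refine ⟨5 / 3 * (B / A) / √(1 + (B / A) ^ 2), fun y => ?_⟩
  obtain ⟨z, rfl⟩ := mix_surjective he t y
  have hbz : b t z = B / A * a t z := by
    have h1 : A * b t z = B * a t z := congrFun hall z
    field_simp
    linarith
  have hs : 0 < √(1 + (B / A) ^ 2) := Real.sqrt_pos.2 (by positivity)
  have hJa : J (mix e t z) = √(1 + (B / A) ^ 2) * a t z := by
    rw [← hab, hbz, show a t z ^ 2 + (B / A * a t z) ^ 2 = (1 + (B / A) ^ 2) * a t z ^ 2 by ring,
      Real.sqrt_mul (by positivity), Real.sqrt_sq (Real.sqrt_nonneg _ : 0 ≤ a t z)]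
  change _ = _ * J (mix e t z)
  rw [hJa, ← mul_assoc, div_mul_cancel₀ _ hs.ne', mul_assoc, ← hbz]
  simp only [hb]
  ring

/-- A function attaining equality in Bobkov's inequality is `Φ` of an affine function. -/
theorem exists_eq_Φ_of_equality {f : E → ℝ} (hf : ContDiff ℝ 1 f)
    (hm : ∀ x, f x ∈ Ioo (0 : ℝ) 1)
    (hi : Integrable (fun x => √(I (f x) ^ 2 + ‖fderiv ℝ f x‖ ^ 2)) (stdGaussian E))
    (heq : ∫ x, √(I (f x) ^ 2 + ‖fderiv ℝ f x‖ ^ 2) ∂(stdGaussian E) =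
      I (∫ x, f x ∂(stdGaussian E))) :
    ∃ (u : E) (v : ℝ), ∀ x, f x = Φ (inner ℝ u x + v) := by
  have hfd := hf.differentiable one_ne_zero
  have hfd' : Continuous (fderiv ℝ f) := hf.continuous_fderiv one_ne_zero
  have hi' : Integrable (fun x => ‖fderiv ℝ f x‖) (stdGaussian E) := by
    refine hi.mono' (by fun_prop) (Eventually.of_forall fun x => ?_)
    rw [norm_norm]
    exact Real.le_sqrt_of_sq_le (le_add_of_nonneg_left (sq_nonneg _))
  set b := stdOrthonormalBasis ℝ E
  choose w hw using fun i => exists_fderiv_eq_mul_sqrt hf hm hi' heq.le (b.norm_eq_one i)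
  set W := ∑ i, w i ^ 2 with hW
  have hJ : ∀ x, √(I (f x) ^ 2 + ‖fderiv ℝ f x‖ ^ 2) ^ 2 * (1 - W) = I (f x) ^ 2 := fun x => by
    have h1 : ‖fderiv ℝ f x‖ ^ 2 = W * √(I (f x) ^ 2 + ‖fderiv ℝ f x‖ ^ 2) ^ 2 := by
      conv_lhs => rw [b.norm_dual]
      rw [hW, Finset.sum_mul]
      exact Finset.sum_congr rfl fun i _ => by rw [hw, mul_pow]
    have h2 := Real.sq_sqrt (by positivity : 0 ≤ I (f x) ^ 2 + ‖fderiv ℝ f x‖ ^ 2)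
    linarith
  have hW1 : 0 < 1 - W := by
    have h1 := hJ 0
    have h2 := pow_pos (I_pos (hm 0)) 2
    rw [← h1] at h2
    exact pos_of_mul_pos_right h2 (sq_nonneg _)
  have hJ' : ∀ x, √(I (f x) ^ 2 + ‖fderiv ℝ f x‖ ^ 2) = (√(1 - W))⁻¹ * I (f x) := fun x => by
    have h1 := congrArg Real.sqrt (hJ x)
    rw [Real.sqrt_mul (sq_nonneg _), Real.sqrt_sq (Real.sqrt_nonneg _),
      Real.sqrt_sq (I_nonneg _)] at h1
    rw [eq_inv_mul_iff_mul_eq₀ (Real.sqrt_pos.2 hW1).ne', mul_comm]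
    exact h1
  set u : E := ∑ i, (w i * (√(1 - W))⁻¹) • b i with hu
  -- Along `b i` the derivative of `ΦInv ∘ f` is `w i * J / I(f) = w i / √(1 - W)`, the
  -- corresponding coordinate of `u`.
  have hg : ∀ x, HasFDerivAt (fun x => ΦInv (f x) - inner ℝ u x) (0 : E →L[ℝ] ℝ) x := fun x => by
    have h1 := ((hasDerivAt_ΦInv (hm x)).comp_hasFDerivAt x (hfd x).hasFDerivAt).sub
      (innerSL ℝ u).hasFDerivAt
    convert! h1 using 1
    refine ContinuousLinearMap.coe_injective (b.toBasis.ext fun i => ?_)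
    have h2 : inner ℝ u (b i) = w i * (√(1 - W))⁻¹ := by
      rw [hu, b.orthonormal.inner_left_fintype]; simp
    simp [hw, hJ', h2]
    have := (I_pos (hm x)).ne'
    field_simp
    simp
  have hconst : ∀ x, ΦInv (f x) - inner ℝ u x = ΦInv (f 0) - inner ℝ u 0 := fun x =>
    is_const_of_fderiv_eq_zero (fun x => (hg x).differentiableAt) (fun x => (hg x).fderiv) x 0
  refine ⟨u, ΦInv (f 0) - inner ℝ u 0, fun x => ?_⟩
  rw [← hconst x, add_sub_cancel, Φ_ΦInv (hm x)]

end FiniteDimensional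

/-! ### The converse: Gaussian integrals of `Φ` and `φ` of affine functions. -/

/-- By symmetry of `s`, the left side is the probability that `s + Z ≤ v` with `Z` an independent
standard Gaussian, and `s + Z` has variance `1 + σ²`. -/
lemma integral_Φ_add_gaussianReal (σ : NNReal) (v : ℝ) :
    ∫ s, Φ (s + v) ∂(gaussianReal 0 (σ ^ 2)) = Φ (v / √(1 + (σ : ℝ) ^ 2)) := by
  have hρ : 0 < √(1 + (σ : ℝ) ^ 2) := Real.sqrt_pos.2 (by positivity)
  have h1 : ∫ s, Φ (s + v) ∂(gaussianReal 0 (σ ^ 2)) =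
      ∫ s, Φ (-s + v) ∂(gaussianReal 0 (σ ^ 2)) := by
    conv_lhs => rw [← neg_zero, ← gaussianReal_map_neg]
    have := continuous_Φ
    rw [integral_map (by fun_prop) (by fun_prop)]
  have h2 : ∀ s, Φ (-s + v) =
      ∫ z, (Iic v).indicator (fun _ => (1 : ℝ)) (s + z) ∂(gaussianReal 0 1) := fun s => by
    have : (fun z => (Iic v).indicator (fun _ => (1 : ℝ)) (s + z)) =
        (Iic (-s + v)).indicator fun _ => 1 := by
      ext z
      simp only [indicator_apply, mem_Iic]
      congr 1
      exact propext ⟨fun h => by linarith, fun h => by linarith⟩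
    rw [this, integral_indicator measurableSet_Iic, Φ]
    simp
  have h3 : gaussianReal 0 (σ ^ 2 + 1) =
      (gaussianReal 0 1).map (fun z => √(1 + (σ : ℝ) ^ 2) * z) := by
    rw [gaussianReal_map_const_mul, mul_zero]
    congr 1
    ext
    simp only [NNReal.coe_add, NNReal.coe_pow, NNReal.coe_one, NNReal.coe_mul, NNReal.coe_mk]
    rw [Real.sq_sqrt (by positivity)]
    ring
  rw [h1]
  simp only [h2]
  rw [← integral_conv ((integrable_const 1).indicator measurableSet_Iic),
    gaussianReal_conv_gaussianReal, add_zero, integral_indicator measurableSet_Iic, h3,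
    setIntegral_const, Measure.real, Measure.map_apply (by fun_prop) measurableSet_Iic, Φ,
    Measure.real, smul_eq_mul, mul_one]
  congr 2
  ext z
  simp only [mem_preimage, mem_Iic]
  rw [le_div_iff₀ hρ, mul_comm]

lemma sqrt_I_sq_add_fderiv_sq_Φ {E : Type*} [NormedAddCommGroup E] [InnerProductSpace ℝ E]
    (u : E) (v : ℝ) (x : E) :
    √(I (Φ (inner ℝ u x + v)) ^ 2 + ‖fderiv ℝ (fun x => Φ (inner ℝ u x + v)) x‖ ^ 2) =
      φ (inner ℝ u x + v) * √(1 + ‖u‖ ^ 2) := by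
  have h : HasFDerivAt (fun x => Φ (inner ℝ u x + v)) (φ (inner ℝ u x + v) • innerSL ℝ u) x :=
    (hasDerivAt_Φ _).comp_hasFDerivAt x ((innerSL ℝ u).hasFDerivAt.add_const v)
  rw [h.fderiv, norm_smul, innerSL_apply_norm, I_Φ, Real.norm_of_nonneg (φ_pos _).le, mul_pow,
    ← mul_one_add, Real.sqrt_mul (sq_nonneg _), Real.sqrt_sq (φ_pos _).le]

section FiniteDimensional

variable {E : Type*} [NormedAddCommGroup E] [InnerProductSpace ℝ E] [FiniteDimensional ℝ E]
  [MeasurableSpace E] [BorelSpace E]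

lemma map_inner_stdGaussian (u : E) :
    (stdGaussian E).map (fun x => inner ℝ u x) = gaussianReal 0 (‖u‖₊ ^ 2) := by
  have h := IsGaussian.map_eq_gaussianReal (μ := stdGaussian E) (innerSL ℝ u)
  rw [integral_strongDual_stdGaussian, variance_dual_stdGaussian, innerSL_apply_norm] at h
  convert! h using 2
  ext
  simp

lemma integral_Φ_inner_add (u : E) (v : ℝ) :
    ∫ x, Φ (inner ℝ u x + v) ∂(stdGaussian E) = Φ (v / √(1 + ‖u‖ ^ 2)) := by
  have := continuous_Φ
  have h := integral_Φ_add_gaussianReal ‖u‖₊ v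
  rw [← map_inner_stdGaussian, integral_map (by fun_prop) (by fun_prop)] at h
  exact h

/-- Differentiate `integral_Φ_inner_add` in `v`, under the integral sign with dominating constant
`1`. -/
lemma integral_φ_inner_add (u : E) (v : ℝ) :
    ∫ x, φ (inner ℝ u x + v) ∂(stdGaussian E) = φ (v / √(1 + ‖u‖ ^ 2)) / √(1 + ‖u‖ ^ 2) := by
  have hΦ := continuous_Φ
  have hφ := continuous_φ
  have h1 := (hasDerivAt_integral_of_dominated_loc_of_deriv_le (μ := stdGaussian E)
    (F := fun v x => Φ (inner ℝ u x + v)) (F' := fun v x => φ (inner ℝ u x + v)) (x₀ := v)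
    (s := univ) (bound := fun _ => 1) univ_mem
    (Eventually.of_forall fun v => Continuous.aestronglyMeasurable (by fun_prop))
    (Integrable.of_bound (Continuous.aestronglyMeasurable (by fun_prop)) 1
      (Eventually.of_forall fun x => by
        rw [Real.norm_of_nonneg (Φ_mem _).1.le]; exact (Φ_mem _).2.le))
    (Continuous.aestronglyMeasurable (by fun_prop))
    (Eventually.of_forall fun x v _ => by
      rw [Real.norm_of_nonneg (φ_pos _).le]; exact φ_le_one _)
    (integrable_const 1)
    (Eventually.of_forall fun x v _ => by
      simpa using (hasDerivAt_Φ (inner ℝ u x + v)).comp_const_add (inner ℝ u x) v)).2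
  simp only [integral_Φ_inner_add] at h1
  have h2 : HasDerivAt (fun v => Φ (v / √(1 + ‖u‖ ^ 2)))
      (φ (v / √(1 + ‖u‖ ^ 2)) / √(1 + ‖u‖ ^ 2)) v := by
    simpa [div_eq_mul_inv, Function.comp_def] using (hasDerivAt_Φ (v / √(1 + ‖u‖ ^ 2))).comp v
      ((hasDerivAt_id v).div_const √(1 + ‖u‖ ^ 2))
  exact h1.unique h2

/-- `Φ` of an affine function attains equality in Bobkov's inequality. -/
theorem equality_Φ (u : E) (v : ℝ) :
    Integrable (fun x => √(I (Φ (inner ℝ u x + v)) ^ 2 +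
      ‖fderiv ℝ (fun x => Φ (inner ℝ u x + v)) x‖ ^ 2)) (stdGaussian E) ∧
    ∫ x, √(I (Φ (inner ℝ u x + v)) ^ 2 + ‖fderiv ℝ (fun x => Φ (inner ℝ u x + v)) x‖ ^ 2)
      ∂(stdGaussian E) = I (∫ x, Φ (inner ℝ u x + v) ∂(stdGaussian E)) := by
  have hφ := continuous_φ
  simp only [sqrt_I_sq_add_fderiv_sq_Φ]
  constructor
  · exact (Integrable.of_bound (Continuous.aestronglyMeasurable (by fun_prop)) 1
      (Eventually.of_forall fun x => by
        rw [Real.norm_of_nonneg (φ_pos _).le]; exact φ_le_one _)).mul_const _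
  · rw [integral_mul_const, integral_φ_inner_add, integral_Φ_inner_add, I_Φ, div_mul_cancel₀]
    exact (Real.sqrt_pos.2 (by positivity)).ne'

/-- Characterisation of equality in Bobkov's inequality on a Euclidean space. -/
theorem equality_iff {f : E → ℝ} (hf : ContDiff ℝ 1 f) (hm : ∀ x, f x ∈ Ioo (0 : ℝ) 1) :
    (Integrable (fun x => √(I (f x) ^ 2 + ‖fderiv ℝ f x‖ ^ 2)) (stdGaussian E) ∧
      ∫ x, √(I (f x) ^ 2 + ‖fderiv ℝ f x‖ ^ 2) ∂(stdGaussian E) =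
        I (∫ x, f x ∂(stdGaussian E))) ↔
    ∃ (u : E) (v : ℝ), ∀ x, f x = Φ (inner ℝ u x + v) := by
  refine ⟨fun h => exists_eq_Φ_of_equality hf hm h.1 h.2, ?_⟩
  rintro ⟨u, v, h⟩
  obtain rfl : f = fun x => Φ (inner ℝ u x + v) := funext h
  exact equality_Φ u v

end FiniteDimensional

lemma stdGaussian_real : stdGaussian ℝ = gaussianReal 0 1 := by
  refine Measure.ext_of_charFun ?_
  ext t
  rw [charFun_stdGaussian, charFun_gaussianReal]
  simp [← Complex.ofReal_pow, neg_div]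

end Bobkov

theorem mainTheorem2 :
    (∀ f : ℝ → ℝ, ContDiff ℝ 1 f → (∀ t, f t ∈ Set.Ioo (0 : ℝ) 1) →
      (Bobkov.EqualityCaseReal f ↔ ∃ u v : ℝ, ∀ t, f t = Bobkov.Φ (u * t + v))) ∧
    (∀ (n : ℕ) (f : EuclideanSpace ℝ (Fin n) → ℝ), ContDiff ℝ 1 f →
      (∀ x, f x ∈ Set.Ioo (0 : ℝ) 1) →
      (Bobkov.EqualityCase f ↔
        ∃ (a : EuclideanSpace ℝ (Fin n)) (b : ℝ), ∀ x, f x = Bobkov.Φ (inner ℝ a x + b))) := by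
  refine ⟨fun f hf hm => ?_, fun n f hf hm => ?_⟩
  · have h := Bobkov.equality_iff hf hm
    simp only [Bobkov.stdGaussian_real, ← norm_deriv_eq_norm_fderiv, Real.norm_eq_abs, sq_abs] at h
    rw [Bobkov.EqualityCaseReal, h]
    simp [mul_comm]
  · have h := Bobkov.equality_iff hf hm
    have hg : ∀ x, ‖gradient f x‖ = ‖fderiv ℝ f x‖ := fun x => by
      rw [gradient, LinearIsometryEquiv.norm_map]
    simp only [Bobkov.EqualityCase, hg]
    exact h
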